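/- Let $\mathbb F$ be a field and let $0\neq q\in\mathbb F$ be not a root of unity. For elements $X,Y$ of an associative unital $\mathbb F$-algebra write $[X,Y]=XY-YX$ and $[X,Y]_q=qXY-q^{-1}YX$. The $q$-Onsager algebra $\mathcal O_q$ is the $\mathbb F$-algebra with generators $A,A^*$ and relations $$[A,[A,[A,A^*]_q]_{q^{-1}}]=(q^2-q^{-2})^2[A^*,A],\qquad [A^*,[A^*,[A^*,A]_q]_{q^{-1}}]=(q^2-q^{-2})^2[A,A^*].$$ There is a unique automorphism $L$ of $\mathcal O_q$ (the Lusztig automorphism) such that $$L(A)=A,\qquad L(A^*)=A^*+\frac{[A,[A,A^*]_q]}{(q-q^{-1})(q^2-q^{-2})}.$$ For an automorphism $\sigma$ of $\mathcal O_q$ and an $\mathcal O_q$-module $W$, the module $W$ twisted via $\sigma$ is the vector space $W$ on which each $\xi\in\mathcal O_q$ acts as $\sigma^{-1}(\xi)$ acts on the original module $W$. A tridiagonal pair on a nonzero finite-dimensional vector space $V$ is an ordered pair $S,T$ of diagonalizable linear maps $V\to V$ such that: there is an ordering $V_0,\dots,V_d$ of the eigenspaces of $S$ with $TV_i\subseteq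 V_{i-1}+V_i+V_{i+1}$ for $0\le i\le d$ (where $V_{-1}=V_{d+1}=0$); there is an ordering $V^*_0,\dots,V^*_\delta$ of the eigenspaces of $T$ with $SV^*_i\subseteq V^*_{i-1}+V^*_i+V^*_{i+1}$ for $0\le i\le\delta$ (where $V^*_{-1}=V^*_{\delta+1}=0$); and no subspace of $V$ other than $0$ and $V$ is invariant under both $S$ and $T$. An isomorphism of tridiagonal pairs from $S,T$ on $V$ to $S',T'$ on $V'$ is a linear bijection $\gamma:V\to V'$ with $\gamma S=S'\gamma$ and $\gamma T=T'\gamma$. Let $V$ be an irreducible $\mathcal O_q$-module of finite dimension at least $2$ on which each of $A$, $A^*$ is diagonalizable. Then the eigenvalues of $A$ on $V$ have an ordering $\theta_0,\dots,\theta_d$ (each listed once) that is standard, meaning that $$\theta_{i-1}^2-(q^2+q^{-2})\theta_{i-1}\theta_i+\theta_i^2+(q^2-q^{-2})^2=0\qquad(1\le i\le d).$$ For a standard ordering let $E_i\in\mathrm{End}(V)$ be the projection onto the $\theta_i$-eigenspace of $A$ along the sum of the other eigenspaces of $A$, and define $$t_{ij}=1+\frac{\theta_i-\theta_j}{q-q^{-1}}\,\frac{q\theta_i-q^{-1}\theta_j}{q^2-q^{-2}},\qquad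 t_i=t_{01}t_{12}\cdots t_{i-1,i}\ (t_0=1),\qquad H=\sum_{i=0}^d t_iE_i .$$ 1. The following $\mathcal O_q$-modules are isomorphic: (i) $V$; (ii) $V$ twisted via $L$; (iii) $V$ twisted via $L^{-1}$. Moreover, for every standard ordering, $H$ is an isomorphism of $\mathcal O_q$-modules from (i) to (ii) and from (iii) to (i). 2. The following are isomorphic tridiagonal pairs: (i) the action of $A,A^*$ on $V$; (ii) the action of $A,L(A^*)$ on $V$; (iii) the action of $A,L^{-1}(A^*)$ on $V$. Moreover, for every standard ordering, $H$ is an isomorphism of tridiagonal pairs from (ii) to (i) and from (i) to (iii). -/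

import Mathlib

open scoped BigOperators

universe u v w

/-! ### The `q`-Onsager algebra -/

section QOnsager

/-- The `q`-commutator `[X, Y]_q = q X Y - q⁻¹ Y X` in an `F`-algebra.
The ordinary commutator `X Y - Y X` is Mathlib's `⁅X, Y⁆`. -/
def qComm {F : Type u} [Field F] {R : Type v} [Ring R] [Algebra F R] (q : F) (X Y : R) : R :=
  q • (X * Y) - q⁻¹ • (Y * X)

/-- The `q`-Dolan/Grady relations, imposed on the two free generators
`ι 0` (which becomes `A`) and `ι 1` (which becomes `A*`). -/
inductive QDolanGrady {F : Type u} [Field F] (q : F) :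
    FreeAlgebra F (Fin 2) → FreeAlgebra F (Fin 2) → Prop
  | first : QDolanGrady q
      ⁅FreeAlgebra.ι F (0 : Fin 2), qComm q⁻¹ (FreeAlgebra.ι F (0 : Fin 2))
        (qComm q (FreeAlgebra.ι F (0 : Fin 2)) (FreeAlgebra.ι F (1 : Fin 2)))⁆
      ((q ^ 2 - q⁻¹ ^ 2) ^ 2 • ⁅FreeAlgebra.ι F (1 : Fin 2), FreeAlgebra.ι F (0 : Fin 2)⁆)
  | second : QDolanGrady q
      ⁅FreeAlgebra.ι F (1 : Fin 2), qComm q⁻¹ (FreeAlgebra.ι F (1 : Fin 2))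
        (qComm q (FreeAlgebra.ι F (1 : Fin 2)) (FreeAlgebra.ι F (0 : Fin 2)))⁆
      ((q ^ 2 - q⁻¹ ^ 2) ^ 2 • ⁅FreeAlgebra.ι F (0 : Fin 2), FreeAlgebra.ι F (1 : Fin 2)⁆)

/-- The `q`-Onsager algebra `O_q`: two generators subject to the `q`-Dolan/Grady relations. -/
abbrev QOnsager {F : Type u} [Field F] (q : F) : Type u := RingQuot (QDolanGrady q)

/-- The generator `A` of `O_q`. -/
noncomputable def genA {F : Type u} [Field F] (q : F) : QOnsager q :=
  RingQuot.mkAlgHom F (QDolanGrady q) (FreeAlgebra.ι F 0)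

/-- The generator `A*` of `O_q`. -/
noncomputable def genAstar {F : Type u} [Field F] (q : F) : QOnsager q :=
  RingQuot.mkAlgHom F (QDolanGrady q) (FreeAlgebra.ι F 1)

/-- `L` is the Lusztig automorphism of `O_q`: it fixes `A` and sends `A*` to
`A* + [A, [A, A*]_q] / ((q - q⁻¹)(q² - q⁻²))`. -/
def IsLusztig {F : Type u} [Field F] (q : F) (L : QOnsager q ≃ₐ[F] QOnsager q) : Prop :=
  L (genA q) = genA q ∧
  L (genAstar q) = genAstar q +
    ((q - q⁻¹) * (q ^ 2 - q⁻¹ ^ 2))⁻¹ • ⁅genA q, qComm q (genA q) (genAstar q)⁆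

end QOnsager

/-! ### Twisting a module via an automorphism -/

section Twist

/-- `Twist σ W` is the module `W` twisted via the automorphism `σ`: the same vector space, on
which `ξ` acts as `σ⁻¹ ξ` acts on `W`. -/
def Twist {F : Type u} [Field F] {R : Type v} [Ring R] [Algebra F R]
    (_σ : R ≃ₐ[F] R) (W : Type w) : Type w := W

variable {F : Type u} [Field F] {R : Type v} [Ring R] [Algebra F R]
  (σ : R ≃ₐ[F] R) (W : Type w) [AddCommGroup W]

instance Twist.instAddCommGroup : AddCommGroup (Twist σ W) := inferInstanceAs (AddCommGroup W)

instance Twist.instModuleBase [Module F W] : Module F (Twist σ W) := inferInstanceAs (Module F W)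

noncomputable instance Twist.instModule [Module R W] : Module R (Twist σ W) :=
  Module.compHom W (σ.symm : R →+* R)

/-- The twisted action is again compatible with the scalars. -/
instance Twist.instIsScalarTower [Module F W] [Module R W] [IsScalarTower F R W] :
    IsScalarTower F R (Twist σ W) :=
  ⟨fun c ξ x => by
    change σ.symm (c • ξ) • (show W from x) = c • (σ.symm ξ • (show W from x))
    rw [map_smul, smul_assoc]⟩

/-- The identity map from `W` to `W` twisted via `σ`. -/
def Twist.of (σ : R ≃ₐ[F] R) {W : Type w} [AddCommGroup W] : W ≃+ Twist σ W := AddEquiv.refl W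

theorem Twist.smul_of (σ : R ≃ₐ[F] R) {W : Type w} [AddCommGroup W] [Module R W]
    (ξ : R) (x : W) : ξ • Twist.of σ x = Twist.of σ (σ.symm ξ • x) := rfl

end Twist

/-! ### Diagonalizable maps and their eigenspace projections -/

section Diag

variable {F : Type u} [Field F] {V : Type v} [AddCommGroup V] [Module F V]

/-- `T` is diagonalizable: `V` is spanned by eigenvectors of `T`. -/
def IsDiag (T : Module.End F V) : Prop := ⨆ μ : F, T.eigenspace μ = ⊤

theorem IsDiag.isCompl {T : Module.End F V} (hT : IsDiag T) (μ : F) :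
    IsCompl (T.eigenspace μ) (⨆ ν : F, ⨆ _ : ν ≠ μ, T.eigenspace ν) := by
  refine ⟨T.eigenspaces_iSupIndep μ, ?_⟩
  rw [codisjoint_iff, eq_top_iff, ← (show _ = _ from hT)]
  refine iSup_le fun ν => ?_
  by_cases h : ν = μ
  · subst h
    exact le_sup_left
  · exact le_sup_of_le_right (le_iSup₂_of_le ν h le_rfl)

/-- `E_μ`: the projection onto the `μ`-eigenspace of `T`
that vanishes on the other eigenspaces. -/
noncomputable def eigenProj {T : Module.End F V} (hT : IsDiag T) (μ : F) : Module.End F V :=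
  (T.eigenspace μ).projection _ (hT.isCompl μ)

/-- The sequence `θ_0, …, θ_d` is an ordering of the eigenvalues of `T` (each listed once). -/
def IsEigenvalueOrdering (T : Module.End F V) {d : ℕ} (θ : Fin (d + 1) → F) : Prop :=
  Function.Injective θ ∧ Set.range θ = {μ : F | T.HasEigenvalue μ}

end Diag

/-! ### Tridiagonal pairs -/

section TDPair

variable {F : Type u} [Field F] {V : Type v} [AddCommGroup V] [Module F V]
  {V' : Type w} [AddCommGroup V'] [Module F V']

/-- For a suitable ordering `V_0, …, V_d` of the eigenspaces of `S`, the map `T` satisfies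
`T V_i ⊆ V_{i-1} + V_i + V_{i+1}` for `0 ≤ i ≤ d`, with `V_{-1} = V_{d+1} = 0`. -/
def ActsTridiagonally (S T : Module.End F V) : Prop :=
  ∃ (d : ℕ) (θ : Fin (d + 1) → F), IsEigenvalueOrdering S θ ∧
    ∀ i : Fin (d + 1), (S.eigenspace (θ i)).map T ≤
      ⨆ j : Fin (d + 1), ⨆ _ : (j : ℕ) ≤ i + 1 ∧ (i : ℕ) ≤ j + 1, S.eigenspace (θ j)

/-- The pair `S, T` is a tridiagonal pair on `V`. -/
structure IsTridiagonalPair (S T : Module.End F V) : Prop where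
  nontrivial : Nontrivial V
  finiteDimensional : FiniteDimensional F V
  diag_left : IsDiag S
  diag_right : IsDiag T
  right_on_left : ActsTridiagonally S T
  left_on_right : ActsTridiagonally T S
  irreducible : ∀ W : Submodule F V, W.map S ≤ W → W.map T ≤ W → W = ⊥ ∨ W = ⊤

/-- The map `γ` is an isomorphism of tridiagonal pairs from `S, T` on `V` to `S', T'` on `V'`. -/
structure IsTDIso (γ : V →ₗ[F] V') (S T : Module.End F V) (S' T' : Module.End F V') : Prop where
  source : IsTridiagonalPair S T
  target : IsTridiagonalPair S' T'
  bijective : Function.Bijective γ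
  comm_left : γ ∘ₗ S = S' ∘ₗ γ
  comm_right : γ ∘ₗ T = T' ∘ₗ γ

/-- Isomorphic tridiagonal pairs. -/
def TDIsomorphic (S T : Module.End F V) (S' T' : Module.End F V') : Prop :=
  ∃ γ : V →ₗ[F] V', IsTDIso γ S T S' T'

end TDPair

/-! ### The map `H` -/

section MapH

variable {F : Type u} [Field F]

/-- Adjacency of scalars: `μ ≠ ν` and `μ² - (q² + q⁻²) μ ν + ν² + (q² - q⁻²)² = 0`. -/
def QAdjacent (q μ ν : F) : Prop :=
  μ ≠ ν ∧ μ ^ 2 - (q ^ 2 + q⁻¹ ^ 2) * μ * ν + ν ^ 2 + (q ^ 2 - q⁻¹ ^ 2) ^ 2 = 0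

/-- `t(μ, ν) = 1 + (μ - ν)/(q - q⁻¹) · (q μ - q⁻¹ ν)/(q² - q⁻²)`, so that
`t_{ij} = t(θ_i, θ_j)`. -/
def tPair (q μ ν : F) : F :=
  1 + (μ - ν) / (q - q⁻¹) * ((q * μ - q⁻¹ * ν) / (q ^ 2 - q⁻¹ ^ 2))

/-- `t_i = t_{01} t_{12} ⋯ t_{i-1,i}`, with `t_0 = 1`. -/
def tCoeff (q : F) {d : ℕ} (θ : Fin (d + 1) → F) (i : Fin (d + 1)) : F :=
  ∏ k : Fin d, if (k : ℕ) < i then tPair q (θ k.castSucc) (θ k.succ) else 1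

variable {V : Type v} [AddCommGroup V] [Module F V]

/-- `θ_0, …, θ_d` is an ordering of the eigenvalues of `T` in which consecutive ones are
adjacent. -/
def IsStandardOrdering (q : F) (T : Module.End F V) {d : ℕ} (θ : Fin (d + 1) → F) : Prop :=
  IsEigenvalueOrdering T θ ∧ ∀ k : Fin d, QAdjacent q (θ k.castSucc) (θ k.succ)

/-- `H = ∑ t_i E_i`, where `E_i` is the projection onto the `θ_i`-eigenspace of `T`. -/
noncomputable def mapH (q : F) {T : Module.End F V} (hT : IsDiag T) {d : ℕ}
    (θ : Fin (d + 1) → F) : Module.End F V :=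
  ∑ i, tCoeff q θ i • eigenProj hT (θ i)

/-- The action on `V` of an element of an algebra `R`. -/
def actOn {R : Type w} [Ring R] [Algebra F R] (V : Type v) [AddCommGroup V] [Module F V]
    [Module R V] [IsScalarTower F R V] (X : R) : Module.End F V :=
  Algebra.lsmul F F V X

end MapH

/-! Write `B` for `A*`. Left and right multiplication by `A` commute, so a polynomial in two
variables acts on the algebra by `x₀^i x₁^j ↦ (Y ↦ A^i Y A^j)`. The first relation says that
`dolanGradyPoly` annihilates `B`, and `L(B)` is a scaled `lusztigPoly` applied to `B`. Hence `L`
preserves the first relation at once. It is inverted by its analogue for `q⁻¹`, since the product of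
the two polynomials is constant modulo `dolanGradyPoly` (`lusztigPoly_mul_swap`). The second
relation involves words with three factors `B`, hence four slots for powers of `A`. Modulo
`dolanGradyPoly` on neighbouring slots, applying `L` to all three factors is a two-slot operation on
the outer slots (`lusztigPoly_mul_cubic`), and this operation agrees with `L` on the linear side of
the relation.

On `V`, with `E_μ` the projection onto the `μ`-eigenspace of `A`, sandwiching the first relation
between projections shows that `E_ν B E_μ` can be nonzero only if `ν = μ` or the two are adjacent. A
scalar has at most two neighbours, so by irreducibility the eigenvalues form a single chain. Since
`q` is not a root of unity, the chain does not close into a cycle (`IsAdjacentChain.not_adj`), so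
`B` acts tridiagonally.

Finally `E_j L(B) E_i = t_{ji} E_j B E_i`, and `t_j t_{ji} = t_i` whenever `|i - j| ≤ 1`; together
these give `H L(B) = B H` (`mapH_lusztigElt`). As `H` commutes with `A` and is invertible, all the
isomorphisms follow. -/

/-! ### Polynomial identities behind the Lusztig automorphism -/

section SlotPolynomials

variable {B : Type u} [CommRing B]

/-- The two-slot polynomial expressing the first `q`-Dolan/Grady relation, with `a = q` and
`b = q⁻¹`. Factors `a * b` make it homogeneous, as in the polynomials below. -/
def dolanGradyPoly (a b x y : B) : B :=
  (x - y) * (a * b * x ^ 2 - (a ^ 2 + b ^ 2) * x * y + a * b * y ^ 2 + (a ^ 2 - b ^ 2) ^ 2)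

/-- The two-slot polynomial of the Lusztig automorphism, multiplied by `(q - q⁻¹)(q² - q⁻²)`. -/
def lusztigPoly (a b x y : B) : B :=
  (a - b) * (a ^ 2 - b ^ 2) + (x - y) * (a * x - b * y)

/-- A two-slot polynomial that describes the Lusztig automorphism on products of three factors
`A*`, multiplied by `(q - q⁻¹)(q² - q⁻²)(q³ - q⁻³)(q⁴ - q⁻⁴)`. -/
def lusztigPolyExt (a b x y : B) : B :=
  (a ^ 3 - b ^ 3) * (a ^ 4 - b ^ 4) * lusztigPoly a b x y +
    a * b * dolanGradyPoly a b x y * (a ^ 2 * x - b ^ 2 * y)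

/-- The four-slot polynomial expressing the cubic part of the second `q`-Dolan/Grady relation. -/
def dolanGradyCubic (a b x0 x1 x2 x3 : B) : B :=
  a * b * (x3 - x0) - (a ^ 2 + a * b + b ^ 2) * (x2 - x1)

/-- The first cofactor in `lusztigPoly_mul_cubic`. -/
def cofactorLeft (a b x0 x1 x2 x3 : B) : B :=
  (a ^ 3 - b ^ 3) * (a ^ 4 - b ^ 4) * (-a * b ^ 2 * x1 ^ 4 + (a * b ^ 2 + b ^ 3) * x1 ^ 3 * x2 +
    (a ^ 2 * b + a * b ^ 2) * x1 ^ 3 * x3 - (a ^ 2 * b + 2 * a * b ^ 2 + b ^ 3) * x1 ^ 2 * x2 *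
    x3 - a ^ 2 * b * x1 ^ 2 * x3 ^ 2 - b ^ 3 * x1 ^ 2 * x2 ^ 2 + (a * b ^ 2 + b ^ 3) * x1 *
    x2 ^ 2 * x3 + (a ^ 2 * b + a * b ^ 2) * x1 * x2 * x3 ^ 2 - a * b ^ 2 * x2 ^ 2 * x3 ^ 2) +
  (a - b) * (a ^ 2 - b ^ 2) ^ 2 * (a ^ 3 - b ^ 3) * (-(a ^ 4 + 2 * a ^ 3 * b + 2 * a ^ 2 * b ^ 2
    + a * b ^ 3 + b ^ 4) * x1 ^ 2 + (a ^ 4 + 2 * a ^ 3 * b + 2 * a ^ 2 * b ^ 2 + a * b ^ 3 +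
    b ^ 4) * x1 * x2 + (a ^ 4 + a ^ 3 * b + 2 * a ^ 2 * b ^ 2 + 2 * a * b ^ 3 + b ^ 4) * x1 * x3
    + a ^ 3 * b * x0 * x2) +
  (a ^ 2 - b ^ 2) ^ 2 * (a ^ 3 - b ^ 3) * (a ^ 4 - b ^ 4) * (-(a + b) * x2 * x3) +
  (a - b) * (a ^ 2 - b ^ 2) ^ 2 * (a ^ 4 - b ^ 4) * (a ^ 2 * b * x3 ^ 2) +
  (a - b) ^ 2 * (a ^ 2 - b ^ 2) ^ 2 * (a ^ 4 * b ^ 2 * x0 ^ 2 - (a ^ 5 * b + 2 * a ^ 4 * b ^ 2 +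
    a ^ 3 * b ^ 3 + a ^ 2 * b ^ 4) * x0 * x3)

/-- The second cofactor in `lusztigPoly_mul_cubic`. -/
def cofactorMid (a b x0 x1 x2 x3 : B) : B :=
  (a ^ 2 - b ^ 2) ^ 2 * (a ^ 3 - b ^ 3) ^ 2 * (a ^ 2 * x2 ^ 2) +
  (a ^ 3 - b ^ 3) * (a ^ 4 - b ^ 4) * ((a ^ 3 + a ^ 2 * b) * x0 ^ 2 * x2 ^ 2 - (a ^ 3 + 2 *
    a ^ 2 * b + a * b ^ 2) * x0 * x1 * x2 ^ 2 + (a ^ 2 * b + a * b ^ 2) * x1 ^ 2 * x2 ^ 2 -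
    (a ^ 3 + a ^ 2 * b + a * b ^ 2) * x0 ^ 2 * x1 * x2 - (a ^ 3 + 2 * a ^ 2 * b + a * b ^ 2) *
    x0 ^ 2 * x2 * x3 + a ^ 2 * b * x0 ^ 3 * x2 + (a ^ 3 + a ^ 2 * b + a * b ^ 2) * x0 * x1 ^ 2 *
    x2 + (a ^ 3 + 3 * a ^ 2 * b + 3 * a * b ^ 2 + b ^ 3) * x0 * x1 * x2 * x3 - a ^ 2 * b *
    x1 ^ 3 * x2 - (a ^ 2 * b + 2 * a * b ^ 2 + b ^ 3) * x1 ^ 2 * x2 * x3 - (a ^ 2 * b + a *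
    b ^ 2 + b ^ 3) * x0 ^ 2 * x1 ^ 2 + (a ^ 3 + 2 * a ^ 2 * b + 2 * a * b ^ 2 + b ^ 3) * x0 ^ 2
    * x1 * x3 + a * b ^ 2 * x0 ^ 3 * x1 + (a ^ 2 * b + a * b ^ 2) * x0 ^ 2 * x3 ^ 2 - (a ^ 2 * b
    + a * b ^ 2) * x0 ^ 3 * x3 + (a ^ 2 * b + a * b ^ 2 + b ^ 3) * x0 * x1 ^ 3 - (a ^ 3 + 2 *
    a ^ 2 * b + 2 * a * b ^ 2 + b ^ 3) * x0 * x1 ^ 2 * x3 - (a ^ 2 * b + 2 * a * b ^ 2 + b ^ 3)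
    * x0 * x1 * x3 ^ 2 - a * b ^ 2 * x1 ^ 4 + (a ^ 2 * b + a * b ^ 2) * x1 ^ 3 * x3 + (a * b ^ 2
    + b ^ 3) * x1 ^ 2 * x3 ^ 2) +
  (a - b) * (a ^ 2 - b ^ 2) * (a ^ 3 - b ^ 3) * (a ^ 4 - b ^ 4) * (-a ^ 2 * x1 * x2) +
  (a - b) * (a ^ 2 - b ^ 2) ^ 2 * (a ^ 3 - b ^ 3) * (-(a ^ 4 + 2 * a ^ 3 * b + a ^ 2 * b ^ 2 + a
    * b ^ 3) * x2 * x3 + a ^ 3 * b * x0 * x2 - a ^ 3 * b * x1 ^ 2 + (a ^ 4 + a ^ 3 * b + a ^ 2 *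
    b ^ 2 + 2 * a * b ^ 3) * x1 * x3 - a * b ^ 3 * x0 * x1) +
  (a - b) * (a ^ 2 - b ^ 2) ^ 2 * (a ^ 4 - b ^ 4) * (a ^ 2 * b * x3 ^ 2 + a * b ^ 2 * x0 ^ 2) +
  (a ^ 2 - b ^ 2) ^ 3 * (a ^ 4 - b ^ 4) * (-a * b * x0 * x3)

/-- The third cofactor in `lusztigPoly_mul_cubic`. -/
def cofactorRight (a b x0 x1 x2 x3 : B) : B :=
  (a - b) ^ 2 * (a ^ 2 - b ^ 2) ^ 2 * (a ^ 2 * b ^ 4 * x3 ^ 2 - (a ^ 4 * b ^ 2 + a ^ 3 * b ^ 3 +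
    2 * a ^ 2 * b ^ 4 + a * b ^ 5) * x0 * x3) +
  (a - b) * (a ^ 2 - b ^ 2) ^ 2 * (a ^ 3 - b ^ 3) * (a * b ^ 3 * x1 * x3 + (a ^ 3 * b + 2 *
    a ^ 2 * b ^ 2 + 2 * a * b ^ 3 + 2 * b ^ 4) * x1 * x2 - a * b ^ 3 * x0 * x2) +
  (a ^ 2 - b ^ 2) ^ 2 * (a ^ 3 - b ^ 3) * (a ^ 4 - b ^ 4) * (-b * x1 ^ 2) +
  (a ^ 2 - b ^ 2) ^ 2 * (a ^ 3 - b ^ 3) ^ 2 * (-b ^ 2 * x2 ^ 2) +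
  (a - b) * (a ^ 2 - b ^ 2) ^ 2 * (a ^ 4 - b ^ 4) * (a * b ^ 2 * x0 ^ 2) +
  (a ^ 3 - b ^ 3) * (a ^ 4 - b ^ 4) * (-a ^ 2 * b * x0 ^ 2 * x1 ^ 2 + (a ^ 2 * b + a * b ^ 2) *
    x0 ^ 2 * x1 * x2 - a * b ^ 2 * x0 ^ 2 * x2 ^ 2 + (a ^ 2 * b + a * b ^ 2) * x0 * x1 ^ 3 -
    (a ^ 2 * b + 2 * a * b ^ 2 + b ^ 3) * x0 * x1 ^ 2 * x2 + (a * b ^ 2 + b ^ 3) * x0 * x1 *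
    x2 ^ 2 - a * b ^ 2 * x1 ^ 4 + (a * b ^ 2 + b ^ 3) * x1 ^ 3 * x2 - b ^ 3 * x1 ^ 2 * x2 ^ 2)

/-- The identity behind the existence of the Lusztig automorphism. -/
theorem lusztigPoly_mul_cubic (a b x0 x1 x2 x3 : B) :
    (a ^ 3 - b ^ 3) * (a ^ 4 - b ^ 4) * (lusztigPoly a b x0 x1 * lusztigPoly a b x1 x2 *
        lusztigPoly a b x2 x3 * dolanGradyCubic a b x0 x1 x2 x3) =
      ((a - b) * (a ^ 2 - b ^ 2)) ^ 2 *
        (lusztigPolyExt a b x0 x3 * dolanGradyCubic a b x0 x1 x2 x3) +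
      dolanGradyPoly a b x0 x1 * cofactorLeft a b x0 x1 x2 x3 +
      dolanGradyPoly a b x1 x2 * cofactorMid a b x0 x1 x2 x3 +
      dolanGradyPoly a b x2 x3 * cofactorRight a b x0 x1 x2 x3 := by
  -- The cofactors are an explicit certificate of membership in the ideal generated by
  -- `dolanGradyPoly` on the three pairs of neighbouring slots.
  unfold lusztigPolyExt lusztigPoly dolanGradyCubic dolanGradyPoly cofactorLeft cofactorMid
    cofactorRight
  ring

end SlotPolynomials

/-! ### Polynomials acting on words in `A` and `Y` -/

section Sandwich

open MvPolynomial

variable {F : Type u} [Field F] {R : Type v} [Ring R] [Algebra F R]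

/-- The linear map `x₀^i x₁^j ↦ A^i Y A^j`. -/
noncomputable def sandwich (A Y : R) : MvPolynomial (Fin 2) F →ₗ[F] R :=
  (basisMonomials (Fin 2) F).constr F fun s => A ^ s 0 * Y * A ^ s 1

/-- The linear map `x₀^i x₁^j x₂^k x₃^l ↦ A^i Y₁ A^j Y₂ A^k Y₃ A^l`. -/
noncomputable def sandwichTriple (A Y₁ Y₂ Y₃ : R) : MvPolynomial (Fin 4) F →ₗ[F] R :=
  (basisMonomials (Fin 4) F).constr F
    fun s => A ^ s 0 * Y₁ * A ^ s 1 * Y₂ * A ^ s 2 * Y₃ * A ^ s 3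

theorem sandwich_monomial (A Y : R) (s : Fin 2 →₀ ℕ) (c : F) :
    sandwich A Y (monomial s c) = c • (A ^ s 0 * Y * A ^ s 1) := by
  have h := (basisMonomials (Fin 2) F).constr_basis F
    (fun s => A ^ s 0 * Y * A ^ s 1) s
  rw [coe_basisMonomials] at h
  rw [← mul_one c, ← smul_eq_mul, ← smul_monomial, map_smul, smul_eq_mul, mul_one]
  exact congrArg _ h

theorem sandwichTriple_monomial (A Y₁ Y₂ Y₃ : R) (s : Fin 4 →₀ ℕ) (c : F) :
    sandwichTriple A Y₁ Y₂ Y₃ (monomial s c) =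
      c • (A ^ s 0 * Y₁ * A ^ s 1 * Y₂ * A ^ s 2 * Y₃ * A ^ s 3) := by
  have h := (basisMonomials (Fin 4) F).constr_basis F
    (fun s => A ^ s 0 * Y₁ * A ^ s 1 * Y₂ * A ^ s 2 * Y₃ * A ^ s 3) s
  rw [coe_basisMonomials] at h
  rw [← mul_one c, ← smul_eq_mul, ← smul_monomial, map_smul, smul_eq_mul, mul_one]
  exact congrArg _ h

/-- Additivity of `sandwich` in the middle argument. -/
theorem sandwich_add_arg (A Y Y' : R) (p : MvPolynomial (Fin 2) F) :
    sandwich A (Y + Y') p = sandwich A Y p + sandwich A Y' p := by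
  induction p using MvPolynomial.induction_on' with
  | monomial s c => simp only [sandwich_monomial, ← smul_add]; noncomm_ring
  | add p p' hp hp' => simp only [map_add, hp, hp']; abel

theorem sandwichTriple_add_left (A Y Y' Y₂ Y₃ : R) (p : MvPolynomial (Fin 4) F) :
    sandwichTriple A (Y + Y') Y₂ Y₃ p =
      sandwichTriple A Y Y₂ Y₃ p + sandwichTriple A Y' Y₂ Y₃ p := by
  induction p using MvPolynomial.induction_on' with
  | monomial s c => simp only [sandwichTriple_monomial, ← smul_add, mul_add, add_mul]
  | add p p' hp hp' => simp only [map_add, hp, hp']; abel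

theorem sandwichTriple_add_mid (A Y₁ Y Y' Y₃ : R) (p : MvPolynomial (Fin 4) F) :
    sandwichTriple A Y₁ (Y + Y') Y₃ p =
      sandwichTriple A Y₁ Y Y₃ p + sandwichTriple A Y₁ Y' Y₃ p := by
  induction p using MvPolynomial.induction_on' with
  | monomial s c => simp only [sandwichTriple_monomial, ← smul_add, mul_add, add_mul]
  | add p p' hp hp' => simp only [map_add, hp, hp']; abel

theorem sandwichTriple_add_right (A Y₁ Y₂ Y Y' : R) (p : MvPolynomial (Fin 4) F) :
    sandwichTriple A Y₁ Y₂ (Y + Y') p =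
      sandwichTriple A Y₁ Y₂ Y p + sandwichTriple A Y₁ Y₂ Y' p := by
  induction p using MvPolynomial.induction_on' with
  | monomial s c => simp only [sandwichTriple_monomial, ← smul_add, mul_add, add_mul]
  | add p p' hp hp' => simp only [map_add, hp, hp']; abel

/-- Powers of `A` commute with one another, so multiplying polynomials composes the operators they
define on the algebra. -/
theorem sandwich_mul (A Y : R) (r p : MvPolynomial (Fin 2) F) :
    sandwich A Y (r * p) = sandwich A (sandwich A Y r) p := by
  induction p using MvPolynomial.induction_on' with
  | add p p' hp hp' => simp only [mul_add, map_add, hp, hp']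
  | monomial s c =>
    induction r using MvPolynomial.induction_on' with
    | add r r' hr hr' => simp only [add_mul, map_add, hr, hr', sandwich_add_arg]
    | monomial t d =>
      simp only [monomial_mul, sandwich_monomial, Finsupp.add_apply, mul_smul_comm, smul_mul_assoc,
        smul_smul]
      rw [mul_comm, pow_add, pow_mul_comm, pow_add]
      simp only [mul_assoc]

theorem aeval_pair_monomial (i j : Fin 4) (s : Fin 2 →₀ ℕ) (c : F) :
    aeval (![X i, X j] : Fin 2 → MvPolynomial (Fin 4) F) (monomial s c) =
      monomial (Finsupp.single i (s 0) + Finsupp.single j (s 1)) c := by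
  rw [aeval_monomial, Finsupp.prod_fintype _ _ (by simp), Fin.prod_univ_two]
  simp [X_pow_eq_monomial, monomial_mul, algebraMap_eq, C_mul_monomial]

/-- A polynomial in two neighbouring slots only affects the factor between them. This and its two
analogues turn substitution of `L(A*)` for a factor into multiplication of polynomials. -/
theorem sandwichTriple_mul_left (A Y₁ Y₂ Y₃ : R) (r : MvPolynomial (Fin 2) F)
    (p : MvPolynomial (Fin 4) F) :
    sandwichTriple A Y₁ Y₂ Y₃ (aeval ![X 0, X 1] r * p) =
      sandwichTriple A (sandwich A Y₁ r) Y₂ Y₃ p := by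
  induction p using MvPolynomial.induction_on' with
  | add p p' hp hp' => simp only [mul_add, map_add, hp, hp']
  | monomial s c =>
    induction r using MvPolynomial.induction_on' with
    | add r r' hr hr' => simp only [add_mul, map_add, hr, hr', sandwichTriple_add_left]
    | monomial t d =>
      simp only [aeval_pair_monomial, monomial_mul, sandwichTriple_monomial, sandwich_monomial,
        Finsupp.add_apply, mul_smul_comm, smul_mul_assoc, smul_smul, mul_comm c d]
      simp [pow_add, mul_assoc]
      rw [← mul_assoc (A ^ t 0), pow_mul_comm, mul_assoc]

theorem sandwichTriple_mul_mid (A Y₁ Y₂ Y₃ : R) (r : MvPolynomial (Fin 2) F)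
    (p : MvPolynomial (Fin 4) F) :
    sandwichTriple A Y₁ Y₂ Y₃ (aeval ![X 1, X 2] r * p) =
      sandwichTriple A Y₁ (sandwich A Y₂ r) Y₃ p := by
  induction p using MvPolynomial.induction_on' with
  | add p p' hp hp' => simp only [mul_add, map_add, hp, hp']
  | monomial s c =>
    induction r using MvPolynomial.induction_on' with
    | add r r' hr hr' => simp only [add_mul, map_add, hr, hr', sandwichTriple_add_mid]
    | monomial t d =>
      simp only [aeval_pair_monomial, monomial_mul, sandwichTriple_monomial, sandwich_monomial,
        Finsupp.add_apply, mul_smul_comm, smul_mul_assoc, smul_smul, mul_comm c d]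
      simp [pow_add, mul_assoc]
      rw [← mul_assoc (A ^ t 0), pow_mul_comm, mul_assoc]

theorem sandwichTriple_mul_right (A Y₁ Y₂ Y₃ : R) (r : MvPolynomial (Fin 2) F)
    (p : MvPolynomial (Fin 4) F) :
    sandwichTriple A Y₁ Y₂ Y₃ (aeval ![X 2, X 3] r * p) =
      sandwichTriple A Y₁ Y₂ (sandwich A Y₃ r) p := by
  induction p using MvPolynomial.induction_on' with
  | add p p' hp hp' => simp only [mul_add, map_add, hp, hp']
  | monomial s c =>
    induction r using MvPolynomial.induction_on' with
    | add r r' hr hr' => simp only [add_mul, map_add, hr, hr', sandwichTriple_add_right]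
    | monomial t d =>
      simp only [aeval_pair_monomial, monomial_mul, sandwichTriple_monomial, sandwich_monomial,
        Finsupp.add_apply, mul_smul_comm, smul_mul_assoc, smul_smul, mul_comm c d]
      simp [pow_add, mul_assoc]
      rw [← mul_assoc (A ^ t 0), pow_mul_comm, mul_assoc]

/-- The extreme slots are the powers of `A` outside the word, so a polynomial in them acts on the
word as a whole. -/
theorem sandwichTriple_mul_outer (A Y₁ Y₂ Y₃ : R) (r : MvPolynomial (Fin 2) F)
    (p : MvPolynomial (Fin 4) F) :
    sandwichTriple A Y₁ Y₂ Y₃ (aeval ![X 0, X 3] r * p) =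
      sandwich A (sandwichTriple A Y₁ Y₂ Y₃ p) r := by
  induction r using MvPolynomial.induction_on' with
  | add r r' hr hr' => simp only [add_mul, map_add, hr, hr']
  | monomial t d =>
    induction p using MvPolynomial.induction_on' with
    | add p p' hp hp' => simp only [mul_add, map_add, hp, hp', sandwich_add_arg]
    | monomial s c =>
      simp only [aeval_pair_monomial, monomial_mul, sandwichTriple_monomial, sandwich_monomial,
        Finsupp.add_apply, mul_smul_comm, smul_mul_assoc, smul_smul]
      simp [pow_add, mul_assoc]
      rw [← pow_add, add_comm, pow_add]

theorem sandwich_one (A Y : R) : sandwich A Y (1 : MvPolynomial (Fin 2) F) = Y := by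
  rw [← C_1, ← monomial_zero', sandwich_monomial]; simp

theorem sandwich_X_zero_mul (A Y : R) (p : MvPolynomial (Fin 2) F) :
    sandwich A Y (X 0 * p) = A * sandwich A Y p := by
  rw [mul_comm, sandwich_mul, X, sandwich_monomial]; simp

theorem sandwich_X_one_mul (A Y : R) (p : MvPolynomial (Fin 2) F) :
    sandwich A Y (X 1 * p) = sandwich A Y p * A := by
  rw [mul_comm, sandwich_mul, X, sandwich_monomial]; simp

theorem sandwich_zero_arg (A : R) (p : MvPolynomial (Fin 2) F) : sandwich A 0 p = 0 := by
  simpa using sandwich_add_arg A 0 0 p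

theorem sandwichTriple_X_zero (A Y₁ Y₂ Y₃ : R) :
    sandwichTriple A Y₁ Y₂ Y₃ (X 0 : MvPolynomial (Fin 4) F) = A * Y₁ * Y₂ * Y₃ := by
  rw [X, sandwichTriple_monomial]; simp

theorem sandwichTriple_X_one (A Y₁ Y₂ Y₃ : R) :
    sandwichTriple A Y₁ Y₂ Y₃ (X 1 : MvPolynomial (Fin 4) F) = Y₁ * A * Y₂ * Y₃ := by
  rw [X, sandwichTriple_monomial]; simp

theorem sandwichTriple_X_two (A Y₁ Y₂ Y₃ : R) :
    sandwichTriple A Y₁ Y₂ Y₃ (X 2 : MvPolynomial (Fin 4) F) = Y₁ * Y₂ * A * Y₃ := by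
  rw [X, sandwichTriple_monomial]; simp

theorem sandwichTriple_X_three (A Y₁ Y₂ Y₃ : R) :
    sandwichTriple A Y₁ Y₂ Y₃ (X 3 : MvPolynomial (Fin 4) F) = Y₁ * Y₂ * Y₃ * A := by
  rw [X, sandwichTriple_monomial]; simp

end Sandwich

/-! ### The Lusztig map preserves the `q`-Dolan/Grady relations -/

section LusztigRelations

open MvPolynomial

/-- The identity `lusztigPoly_mul_cubic` normalised, so that each factor `c * lusztigPoly` is
exactly the operator producing `L(A*)`. -/
theorem scaled_lusztigPoly_mul_cubic {B : Type u} [CommRing B] {a b c d : B}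
    (hc : c * ((a - b) * (a ^ 2 - b ^ 2)) = 1) (hd : d * ((a ^ 3 - b ^ 3) * (a ^ 4 - b ^ 4)) = 1)
    (x0 x1 x2 x3 : B) :
    c * lusztigPoly a b x0 x1 * (c * lusztigPoly a b x1 x2 * (c * lusztigPoly a b x2 x3 *
        dolanGradyCubic a b x0 x1 x2 x3)) =
      c * d * lusztigPolyExt a b x0 x3 * dolanGradyCubic a b x0 x1 x2 x3 +
      dolanGradyPoly a b x0 x1 * (c ^ 3 * d * cofactorLeft a b x0 x1 x2 x3) +
      dolanGradyPoly a b x1 x2 * (c ^ 3 * d * cofactorMid a b x0 x1 x2 x3) +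
      dolanGradyPoly a b x2 x3 * (c ^ 3 * d * cofactorRight a b x0 x1 x2 x3) := by
  linear_combination c ^ 3 * d * lusztigPoly_mul_cubic a b x0 x1 x2 x3 -
    c ^ 3 * (lusztigPoly a b x0 x1 * lusztigPoly a b x1 x2 * lusztigPoly a b x2 x3 *
      dolanGradyCubic a b x0 x1 x2 x3) * hd +
    c * d * lusztigPolyExt a b x0 x3 * dolanGradyCubic a b x0 x1 x2 x3 *
      (c * ((a - b) * (a ^ 2 - b ^ 2)) + 1) * hc

/-- Exchanging `a` and `b` replaces `q` by `q⁻¹`. Modulo `dolanGradyPoly` the two Lusztig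
polynomials are therefore inverse up to a scalar; this serves both for `L⁻¹` and for `t_{ij} t_{ji}
= 1`. -/
theorem lusztigPoly_mul_swap {B : Type u} [CommRing B] (a b x y : B) :
    lusztigPoly a b x y * lusztigPoly b a x y =
      ((a - b) * (a ^ 2 - b ^ 2)) ^ 2 + dolanGradyPoly a b x y * (x - y) := by
  unfold lusztigPoly dolanGradyPoly
  ring

variable {F : Type u} [Field F] {R : Type v} [Ring R] [Algebra F R]

/-- The `q`-Dolan/Grady relations for a pair of elements of an algebra. -/
structure IsDolanGradyPair (q : F) (A B : R) : Prop where
  first : ⁅A, qComm q⁻¹ A (qComm q A B)⁆ = (q ^ 2 - q⁻¹ ^ 2) ^ 2 • ⁅B, A⁆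
  second : ⁅B, qComm q⁻¹ B (qComm q B A)⁆ = (q ^ 2 - q⁻¹ ^ 2) ^ 2 • ⁅A, B⁆

/-- The image of `A*` under the Lusztig automorphism, for arbitrary algebra elements. -/
def lusztigElt (q : F) (A B : R) : R :=
  B + ((q - q⁻¹) * (q ^ 2 - q⁻¹ ^ 2))⁻¹ • ⁅A, qComm q A B⁆

theorem IsDolanGradyPair.swap {q : F} {A B : R} (h : IsDolanGradyPair q A B) :
    IsDolanGradyPair q B A := ⟨h.second, h.first⟩

theorem lie_qComm_qComm {q : F} (hq : q ≠ 0) (A B : R) :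
    ⁅A, qComm q⁻¹ A (qComm q A B)⁆ =
      A * (A * (A * B)) - (q ^ 2 + 1 + q⁻¹ ^ 2) • (A * (A * (B * A))) +
        (q ^ 2 + 1 + q⁻¹ ^ 2) • (A * (B * (A * A))) - B * (A * (A * A)) := by
  simp only [qComm, Ring.lie_def, mul_sub, sub_mul, smul_sub, mul_smul_comm, smul_mul_assoc,
    smul_smul, mul_assoc, inv_inv]
  match_scalars <;> field_simp <;> ring

theorem lie_qComm_qComm_inv {q : F} (hq : q ≠ 0) (A B : R) :
    ⁅A, qComm q A (qComm q⁻¹ A B)⁆ = ⁅A, qComm q⁻¹ A (qComm q A B)⁆ := by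
  have h := lie_qComm_qComm (inv_ne_zero hq) A B
  rw [inv_inv] at h
  rw [h, lie_qComm_qComm hq, add_right_comm (q⁻¹ ^ 2), add_right_comm (q ^ 2),
    add_comm (q⁻¹ ^ 2)]

/-- The expanded relations involve `q` only through `q² + 1 + q⁻²` and `(q² - q⁻²)²`, both symmetric
under inversion. -/
theorem IsDolanGradyPair.inv {q : F} (hq : q ≠ 0) {A B : R} (h : IsDolanGradyPair q A B) :
    IsDolanGradyPair q⁻¹ A B := by
  constructor
  · rw [inv_inv, lie_qComm_qComm_inv hq, h.first, ← neg_sub (q ^ 2), neg_sq]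
  · rw [inv_inv, lie_qComm_qComm_inv hq, h.second, ← neg_sub (q ^ 2), neg_sq]

theorem sandwich_dolanGradyPoly {q : F} (hq : q ≠ 0) (A B : R) :
    sandwich A B (dolanGradyPoly (C q) (C q⁻¹) (X 0) (X 1)) =
      ⁅A, qComm q⁻¹ A (qComm q A B)⁆ - (q ^ 2 - q⁻¹ ^ 2) ^ 2 • ⁅B, A⁆ := by
  have hab : (C q * C q⁻¹ : MvPolynomial (Fin 2) F) = 1 := by
    rw [← C_mul, mul_inv_cancel₀ hq, C_1]
  have h : (dolanGradyPoly (C q) (C q⁻¹) (X 0) (X 1) : MvPolynomial (Fin 2) F) =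
      X 0 * (X 0 * (X 0 * 1)) - C (q ^ 2 + 1 + q⁻¹ ^ 2) * (X 0 * (X 0 * (X 1 * 1))) +
        C (q ^ 2 + 1 + q⁻¹ ^ 2) * (X 0 * (X 1 * (X 1 * 1))) - X 1 * (X 1 * (X 1 * 1)) +
        C ((q ^ 2 - q⁻¹ ^ 2) ^ 2) * (X 0 * 1 - X 1 * 1) := by
    simp only [C_add, C_sub, C_pow, C_1]
    unfold dolanGradyPoly
    linear_combination ((X 0 : MvPolynomial (Fin 2) F) - X 1) * (X 0 ^ 2 + X 1 ^ 2) * hab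
  rw [h, lie_qComm_qComm hq]
  simp only [C_mul']
  simp only [map_sub, map_add, map_smul, sandwich_X_zero_mul, sandwich_X_one_mul,
    sandwich_one, Ring.lie_def, mul_assoc]
  module

theorem lusztigElt_eq_sandwich {q : F} (h12 : (q - q⁻¹) * (q ^ 2 - q⁻¹ ^ 2) ≠ 0) (A B : R) :
    lusztigElt q A B = sandwich A B (C ((q - q⁻¹) * (q ^ 2 - q⁻¹ ^ 2))⁻¹ *
      lusztigPoly (C q) (C q⁻¹) (X 0) (X 1)) := by
  have h : (lusztigPoly (C q) (C q⁻¹) (X 0) (X 1) : MvPolynomial (Fin 2) F) =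
      C ((q - q⁻¹) * (q ^ 2 - q⁻¹ ^ 2)) * 1 + C q * (X 0 * (X 0 * 1)) -
        C (q + q⁻¹) * (X 0 * (X 1 * 1)) + C q⁻¹ * (X 1 * (X 1 * 1)) := by
    simp only [C_add, C_sub, C_pow, C_mul]
    unfold lusztigPoly
    ring
  rw [h, C_mul', map_smul]
  simp only [C_mul']
  simp only [map_sub, map_add, map_smul, sandwich_X_zero_mul, sandwich_X_one_mul,
    sandwich_one, smul_add, smul_sub, smul_smul, inv_mul_cancel₀ h12]
  simp only [lusztigElt, qComm, Ring.lie_def, mul_sub, sub_mul, smul_sub, mul_smul_comm,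
    smul_mul_assoc, smul_smul, mul_assoc]
  module

theorem sandwichTriple_dolanGradyCubic {q : F} (hq : q ≠ 0) (A B : R) :
    sandwichTriple A B B B (dolanGradyCubic (C q) (C q⁻¹) (X 0) (X 1) (X 2) (X 3)) =
      ⁅B, qComm q⁻¹ B (qComm q B A)⁆ := by
  have hab : (C q * C q⁻¹ : MvPolynomial (Fin 4) F) = 1 := by
    rw [← C_mul, mul_inv_cancel₀ hq, C_1]
  have h : (dolanGradyCubic (C q) (C q⁻¹) (X 0) (X 1) (X 2) (X 3) : MvPolynomial (Fin 4) F) =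
      X 3 - X 0 - C (q ^ 2 + 1 + q⁻¹ ^ 2) * (X 2 - X 1) := by
    simp only [C_add, C_pow, C_1]
    unfold dolanGradyCubic
    linear_combination ((X 3 : MvPolynomial (Fin 4) F) - X 0 - X 2 + X 1) * hab
  rw [h, lie_qComm_qComm hq]
  simp only [map_sub, C_mul', map_smul, sandwichTriple_X_zero, sandwichTriple_X_one,
    sandwichTriple_X_two, sandwichTriple_X_three, mul_assoc]
  module

/-- The whole ideal generated by `dolanGradyPoly` annihilates `B`, so two-slot polynomials acting on
`B` may be reduced modulo it. -/
theorem IsDolanGradyPair.sandwich_mul_eq_zero {q : F} (hq : q ≠ 0) {A B : R}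
    (h : IsDolanGradyPair q A B) (p : MvPolynomial (Fin 2) F) :
    sandwich A B (dolanGradyPoly (C q) (C q⁻¹) (X 0) (X 1) * p) = 0 := by
  rw [sandwich_mul, sandwich_dolanGradyPoly hq, h.first, sub_self, sandwich_zero_arg]

theorem sandwichTriple_zero_left (A Y₂ Y₃ : R) (p : MvPolynomial (Fin 4) F) :
    sandwichTriple A 0 Y₂ Y₃ p = 0 := by
  simpa using sandwichTriple_add_left A 0 0 Y₂ Y₃ p

theorem sandwichTriple_zero_mid (A Y₁ Y₃ : R) (p : MvPolynomial (Fin 4) F) :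
    sandwichTriple A Y₁ 0 Y₃ p = 0 := by
  simpa using sandwichTriple_add_mid A Y₁ 0 0 Y₃ p

theorem sandwichTriple_zero_right (A Y₁ Y₂ : R) (p : MvPolynomial (Fin 4) F) :
    sandwichTriple A Y₁ Y₂ 0 p = 0 := by
  simpa using sandwichTriple_add_right A Y₁ Y₂ 0 0 p

theorem sub_inv_pow_ne_zero {q : F} (hq0 : q ≠ 0) (hq : ∀ n : ℕ, 0 < n → q ^ n ≠ 1) {n : ℕ}
    (hn : 0 < n) : q ^ n - q⁻¹ ^ n ≠ 0 := by
  intro h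
  apply hq (2 * n) (by omega)
  rw [sub_eq_zero] at h
  rw [two_mul, pow_add]
  nth_rewrite 1 [h]
  rw [← mul_pow, inv_mul_cancel₀ hq0, one_pow]

theorem IsDolanGradyPair.lusztigElt {q : F} (hq0 : q ≠ 0) (hq : ∀ n : ℕ, 0 < n → q ^ n ≠ 1)
    {A B : R} (h : IsDolanGradyPair q A B) : IsDolanGradyPair q A (lusztigElt q A B) := by
  have h1 := sub_inv_pow_ne_zero hq0 hq (n := 1) (by norm_num)
  have h2 := sub_inv_pow_ne_zero hq0 hq (n := 2) (by norm_num)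
  have h3 := sub_inv_pow_ne_zero hq0 hq (n := 3) (by norm_num)
  have h4 := sub_inv_pow_ne_zero hq0 hq (n := 4) (by norm_num)
  rw [pow_one, pow_one] at h1
  set c := ((q - q⁻¹) * (q ^ 2 - q⁻¹ ^ 2))⁻¹ with hc
  set d := ((q ^ 3 - q⁻¹ ^ 3) * (q ^ 4 - q⁻¹ ^ 4))⁻¹ with hd
  have hc1 : c * ((q - q⁻¹) * (q ^ 2 - q⁻¹ ^ 2)) = 1 := inv_mul_cancel₀ (mul_ne_zero h1 h2)
  have hd1 : d * ((q ^ 3 - q⁻¹ ^ 3) * (q ^ 4 - q⁻¹ ^ 4)) = 1 :=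
    inv_mul_cancel₀ (mul_ne_zero h3 h4)
  have hL := lusztigElt_eq_sandwich (mul_ne_zero h1 h2) A B
  rw [← hc] at hL
  have hdg0 := h.sandwich_mul_eq_zero hq0 1
  rw [mul_one] at hdg0
  constructor
  -- The two polynomials commute, so `dolanGradyPoly` may act on `B` first.
  · rw [← sub_eq_zero, ← sandwich_dolanGradyPoly hq0, hL, ← sandwich_mul, mul_comm,
      h.sandwich_mul_eq_zero hq0]
  · rw [← sandwichTriple_dolanGradyCubic hq0, hL, ← sandwichTriple_mul_right,
      ← sandwichTriple_mul_mid, ← sandwichTriple_mul_left]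
    have haev : ∀ i j : Fin 4, aeval (![X i, X j] : Fin 2 → MvPolynomial (Fin 4) F)
        (C c * lusztigPoly (C q) (C q⁻¹) (X 0) (X 1)) =
        C c * lusztigPoly (C q) (C q⁻¹) (X i) (X j) := by
      intro i j; simp [lusztigPoly, algHom_C, algebraMap_eq]
    have haev2 : ∀ i j : Fin 4, aeval (![X i, X j] : Fin 2 → MvPolynomial (Fin 4) F)
        (C c * C d * lusztigPolyExt (C q) (C q⁻¹) (X 0) (X 1)) =
        C c * C d * lusztigPolyExt (C q) (C q⁻¹) (X i) (X j) := by
      intro i j; simp [lusztigPoly, lusztigPolyExt, dolanGradyPoly, algHom_C, algebraMap_eq]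
    have haev3 : ∀ i j : Fin 4, aeval (![X i, X j] : Fin 2 → MvPolynomial (Fin 4) F)
        (dolanGradyPoly (C q) (C q⁻¹) (X 0) (X 1)) =
        dolanGradyPoly (C q) (C q⁻¹) (X i) (X j) := by
      intro i j; simp [dolanGradyPoly, algHom_C, algebraMap_eq]
    have hcC : ∀ {n : ℕ}, (C c * ((C q - C q⁻¹) * (C q ^ 2 - C q⁻¹ ^ 2)) :
        MvPolynomial (Fin n) F) = 1 := by
      intro n; rw [← C_1, ← hc1]; simp only [C_mul, C_sub, C_pow]
    have hdC : ∀ {n : ℕ}, (C d * ((C q ^ 3 - C q⁻¹ ^ 3) * (C q ^ 4 - C q⁻¹ ^ 4)) :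
        MvPolynomial (Fin n) F) = 1 := by
      intro n; rw [← C_1, ← hd1]; simp only [C_mul, C_sub, C_pow]
    -- Commutation with `A` is multiplication by `x₀ - x₁`, which makes the linear side of the
    -- relation polynomial as well.
    have hlin : ∀ p : MvPolynomial (Fin 2) F, sandwich A B
        (p * (C ((q ^ 2 - q⁻¹ ^ 2) ^ 2) * (X 0 - X 1))) =
        (q ^ 2 - q⁻¹ ^ 2) ^ 2 • ⁅A, sandwich A B p⁆ := by
      intro p
      rw [show p * (C ((q ^ 2 - q⁻¹ ^ 2) ^ 2) * (X 0 - X 1)) =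
        C ((q ^ 2 - q⁻¹ ^ 2) ^ 2) * (X 0 * p - X 1 * p) by ring, C_mul', map_smul, map_sub,
        sandwich_X_zero_mul, sandwich_X_one_mul, Ring.lie_def]
    rw [haev, haev, haev, scaled_lusztigPoly_mul_cubic hcC hdC]
    simp only [map_add]
    rw [← haev2, ← haev3 0 1, ← haev3 1 2, ← haev3 2 3, sandwichTriple_mul_left,
      sandwichTriple_mul_mid, sandwichTriple_mul_right, hdg0, sandwichTriple_zero_left,
      sandwichTriple_zero_mid, sandwichTriple_zero_right, add_zero, add_zero, add_zero,
      sandwichTriple_mul_outer, sandwichTriple_dolanGradyCubic hq0, h.second, ← hlin]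
    have hone := hlin 1
    rw [sandwich_one, one_mul] at hone
    rw [← hone, ← sandwich_mul, ← sub_eq_zero, ← map_sub]
    -- Modulo `dolanGradyPoly`, `lusztigPolyExt` is `(q³ - q⁻³)(q⁴ - q⁻⁴)` times `lusztigPoly`, so
    -- after scaling both act alike on `[A, B]`.
    refine Eq.trans (congrArg _ ?_) (h.sandwich_mul_eq_zero hq0
      (C ((q ^ 2 - q⁻¹ ^ 2) ^ 2) * (X 0 - X 1) * (C c * C d * (C q * C q⁻¹ *
        (C q ^ 2 * X 0 - C q⁻¹ ^ 2 * X 1)))))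
    unfold lusztigPolyExt
    linear_combination C ((q ^ 2 - q⁻¹ ^ 2) ^ 2) * (X 0 - X 1) * C c *
      lusztigPoly (C q) (C q⁻¹) (X 0) (X 1) * hdC (n := 2)

theorem lusztigElt_inv_lusztigElt {q : F} (hq0 : q ≠ 0) (hq : ∀ n : ℕ, 0 < n → q ^ n ≠ 1)
    {A B : R} (h : IsDolanGradyPair q A B) : lusztigElt q⁻¹ A (lusztigElt q A B) = B := by
  have h1 := sub_inv_pow_ne_zero hq0 hq (n := 1) (by norm_num)
  have h2 := sub_inv_pow_ne_zero hq0 hq (n := 2) (by norm_num)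
  rw [pow_one, pow_one] at h1
  -- Both factors change sign under inversion of `q`, so the normalising scalar is unchanged.
  have hs : (q⁻¹ - q⁻¹⁻¹) * (q⁻¹ ^ 2 - q⁻¹⁻¹ ^ 2) = (q - q⁻¹) * (q ^ 2 - q⁻¹ ^ 2) := by
    rw [inv_inv]; ring
  rw [lusztigElt_eq_sandwich (by rw [hs]; exact mul_ne_zero h1 h2),
    lusztigElt_eq_sandwich (mul_ne_zero h1 h2), ← sandwich_mul, hs, inv_inv]
  set c := ((q - q⁻¹) * (q ^ 2 - q⁻¹ ^ 2))⁻¹ with hc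
  have hc1 : (C c * ((C q - C q⁻¹) * (C q ^ 2 - C q⁻¹ ^ 2)) : MvPolynomial (Fin 2) F) = 1 := by
    rw [← C_1, ← inv_mul_cancel₀ (mul_ne_zero h1 h2)]; simp only [C_mul, C_sub, C_pow, hc]
  have key : (C c * lusztigPoly (C q) (C q⁻¹) (X 0) (X 1) *
      (C c * lusztigPoly (C q⁻¹) (C q) (X 0) (X 1)) : MvPolynomial (Fin 2) F) =
      1 + dolanGradyPoly (C q) (C q⁻¹) (X 0) (X 1) * (C c ^ 2 * (X 0 - X 1)) := by
    linear_combination C c ^ 2 * lusztigPoly_mul_swap (C q) (C q⁻¹)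
      (X 0 : MvPolynomial (Fin 2) F) (X 1) +
      (C c * ((C q - C q⁻¹) * (C q ^ 2 - C q⁻¹ ^ 2)) + 1) * hc1
  rw [key, map_add, h.sandwich_mul_eq_zero hq0, sandwich_one, add_zero]

end LusztigRelations

/-! ### Existence and uniqueness of the Lusztig automorphism -/

section LusztigAutomorphism

variable {F : Type u} [Field F] {R : Type v} [Ring R] [Algebra F R]

theorem map_qComm {S : Type w} [Ring S] [Algebra F S] (f : R →ₐ[F] S) (q : F) (X Y : R) :
    f (qComm q X Y) = qComm q (f X) (f Y) := by
  simp [qComm]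

theorem map_lie_algHom {S : Type w} [Ring S] [Algebra F S] (f : R →ₐ[F] S) (X Y : R) :
    f ⁅X, Y⁆ = ⁅f X, f Y⁆ := by
  simp [Ring.lie_def]

theorem map_lusztigElt {S : Type w} [Ring S] [Algebra F S] (f : R →ₐ[F] S) (q : F) (X Y : R) :
    f (lusztigElt q X Y) = lusztigElt q (f X) (f Y) := by
  simp [lusztigElt, map_qComm, map_lie_algHom]

theorem IsDolanGradyPair.map {S : Type w} [Ring S] [Algebra F S] (f : R →ₐ[F] S) {q : F}
    {A B : R} (h : IsDolanGradyPair q A B) : IsDolanGradyPair q (f A) (f B) := by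
  constructor
  · simpa [map_qComm, map_lie_algHom] using congrArg f h.first
  · simpa [map_qComm, map_lie_algHom] using congrArg f h.second

theorem isDolanGradyPair_gen (q : F) : IsDolanGradyPair q (genA q) (genAstar q) := by
  constructor
  · simpa [map_qComm, map_lie_algHom, genA, genAstar] using
      RingQuot.mkAlgHom_rel F (QDolanGrady.first (q := q))
  · simpa [map_qComm, map_lie_algHom, genA, genAstar] using
      RingQuot.mkAlgHom_rel F (QDolanGrady.second (q := q))

/-- The homomorphism from `O_q` determined by a pair satisfying the `q`-Dolan/Grady relations. -/
noncomputable def QOnsager.lift {q : F} {A B : R} (h : IsDolanGradyPair q A B) :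
    QOnsager q →ₐ[F] R :=
  RingQuot.liftAlgHom F ⟨FreeAlgebra.lift F ![A, B], by
    rintro _ _ (_ | _)
    · simpa [map_qComm, map_lie_algHom] using h.first
    · simpa [map_qComm, map_lie_algHom] using h.second⟩

theorem QOnsager.lift_genA {q : F} {A B : R} (h : IsDolanGradyPair q A B) :
    QOnsager.lift h (genA q) = A := by
  simp [QOnsager.lift, genA]

theorem QOnsager.lift_genAstar {q : F} {A B : R} (h : IsDolanGradyPair q A B) :
    QOnsager.lift h (genAstar q) = B := by
  simp [QOnsager.lift, genAstar]

theorem QOnsager.algHom_ext {q : F} {f g : QOnsager q →ₐ[F] R} (hA : f (genA q) = g (genA q))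
    (hB : f (genAstar q) = g (genAstar q)) : f = g := by
  apply RingQuot.ringQuot_ext'
  apply FreeAlgebra.hom_ext
  funext i
  fin_cases i
  · exact hA
  · exact hB

/-- The Lusztig automorphism. -/
noncomputable def lusztigEquiv {q : F} (hq0 : q ≠ 0) (hq : ∀ n : ℕ, 0 < n → q ^ n ≠ 1) :
    QOnsager q ≃ₐ[F] QOnsager q :=
  have hq' : ∀ n : ℕ, 0 < n → q⁻¹ ^ n ≠ 1 := fun n hn h => hq n hn (by simpa using h)
  have hd := isDolanGradyPair_gen q
  -- The inverse map is the Lusztig construction for `q⁻¹`, which is legitimate because the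
  -- relations are invariant under inversion of `q`.
  have hi : IsDolanGradyPair q (genA q) (lusztigElt q⁻¹ (genA q) (genAstar q)) := by
    simpa using ((hd.inv hq0).lusztigElt (inv_ne_zero hq0) hq').inv (inv_ne_zero hq0)
  AlgEquiv.ofAlgHom (QOnsager.lift (hd.lusztigElt hq0 hq)) (QOnsager.lift hi)
    (by
      apply QOnsager.algHom_ext
      · simp [QOnsager.lift_genA]
      · simpa [QOnsager.lift_genA, QOnsager.lift_genAstar, map_lusztigElt] using
          lusztigElt_inv_lusztigElt hq0 hq hd)
    (by
      apply QOnsager.algHom_ext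
      · simp [QOnsager.lift_genA]
      · simpa [QOnsager.lift_genA, QOnsager.lift_genAstar, map_lusztigElt] using
          lusztigElt_inv_lusztigElt (inv_ne_zero hq0) hq' (hd.inv hq0))

theorem existsUnique_isLusztig {q : F} (hq0 : q ≠ 0) (hq : ∀ n : ℕ, 0 < n → q ^ n ≠ 1) :
    ∃! L : QOnsager q ≃ₐ[F] QOnsager q, IsLusztig q L := by
  have h0 : IsLusztig q (lusztigEquiv hq0 hq) :=
    ⟨QOnsager.lift_genA _, QOnsager.lift_genAstar _⟩
  refine ⟨lusztigEquiv hq0 hq, h0, ?_⟩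
  rintro L ⟨hA, hB⟩
  apply AlgEquiv.coe_toAlgHom_injective
  apply QOnsager.algHom_ext
  · exact hA.trans h0.1.symm
  · exact hB.trans h0.2.symm

/-- A subset containing the generators and closed under the operations is everything. -/
theorem QOnsager.induction {q : F} {p : QOnsager q → Prop} (hA : p (genA q))
    (hB : p (genAstar q)) (hs : ∀ c : F, p (algebraMap F _ c)) (hadd : ∀ x y, p x → p y → p (x + y))
    (hmul : ∀ x y, p x → p y → p (x * y)) (x : QOnsager q) : p x := by
  obtain ⟨y, rfl⟩ := RingQuot.mkAlgHom_surjective F (QDolanGrady q) x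
  induction y using FreeAlgebra.induction with
  | grade0 c => simpa using hs c
  | grade1 i =>
    fin_cases i
    · exact hA
    · exact hB
  | mul a b ha hb => simpa using hmul _ _ ha hb
  | add a b ha hb => simpa using hadd _ _ ha hb

end LusztigAutomorphism

/-! ### Eigenspace projections of a diagonalizable map -/

section EigenProj

variable {F : Type u} [Field F] {V : Type v} [AddCommGroup V] [Module F V]
  {S : Module.End F V}

theorem IsDiag.hom_ext {W : Type w} [AddCommGroup W] [Module F W] (hS : IsDiag S)
    {f g : V →ₗ[F] W} (h : ∀ μ, ∀ v ∈ S.eigenspace μ, f v = g v) : f = g := by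
  have : (⊤ : Submodule F V) ≤ LinearMap.eqLocus f g := by
    rw [← show _ = _ from hS]
    exact iSup_le fun μ v hv => h μ v hv
  ext v
  exact this trivial

theorem eigenProj_mem (hS : IsDiag S) (μ : F) (v : V) : eigenProj hS μ v ∈ S.eigenspace μ :=
  Submodule.projection_apply_mem _ _

theorem eigenProj_of_mem (hS : IsDiag S) {μ : F} {v : V} (hv : v ∈ S.eigenspace μ) :
    eigenProj hS μ v = v :=
  Submodule.projection_apply_of_mem_left _ hv

theorem eigenProj_of_mem_ne (hS : IsDiag S) {μ ν : F} (h : ν ≠ μ) {v : V}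
    (hv : v ∈ S.eigenspace ν) : eigenProj hS μ v = 0 :=
  (Submodule.projection_apply_eq_zero_iff _).2
    (Submodule.mem_iSup_of_mem ν (Submodule.mem_iSup_of_mem h hv))

theorem eigenProj_apply_map (hS : IsDiag S) (μ : F) (v : V) :
    eigenProj hS μ (S v) = μ • eigenProj hS μ v := by
  have h : eigenProj hS μ ∘ₗ S = μ • eigenProj hS μ := by
    refine hS.hom_ext fun ν w hw => ?_
    rw [LinearMap.comp_apply, Module.End.mem_eigenspace_iff.1 hw, map_smul, LinearMap.smul_apply]
    rcases eq_or_ne ν μ with rfl | hne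
    · rfl
    · rw [eigenProj_of_mem_ne hS hne hw, smul_zero, smul_zero]
  exact LinearMap.congr_fun h v

theorem sum_eigenProj (hS : IsDiag S) {s : Finset F} (hs : ∀ μ, S.HasEigenvalue μ → μ ∈ s)
    (v : V) : ∑ μ ∈ s, eigenProj hS μ v = v := by
  have h : ∑ μ ∈ s, eigenProj hS μ = LinearMap.id := by
    refine hS.hom_ext fun ν w hw => ?_
    rw [LinearMap.sum_apply, LinearMap.id_apply]
    rcases eq_or_ne w 0 with rfl | hw0
    · simp
    · have hν := hs ν (Module.End.hasEigenvalue_of_hasEigenvector ⟨hw, hw0⟩)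
      rw [Finset.sum_eq_single_of_mem ν hν fun μ _ hne => eigenProj_of_mem_ne hS hne.symm hw,
        eigenProj_of_mem hS hw]
  rw [← LinearMap.sum_apply, h, LinearMap.id_apply]

theorem IsEigenvalueOrdering.sum_eigenProj (hS : IsDiag S) {d : ℕ} {θ : Fin (d + 1) → F}
    (hθ : IsEigenvalueOrdering S θ) (v : V) : ∑ i, eigenProj hS (θ i) v = v := by
  classical
  rw [← Finset.sum_image (f := fun μ => eigenProj hS μ v) (s := Finset.univ) (g := θ)
    hθ.1.injOn]
  refine _root_.sum_eigenProj hS (fun μ hμ => ?_) v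
  have : μ ∈ Set.range θ := hθ.2 ▸ hμ
  simpa using this

end EigenProj

/-! ### Chains of adjacent scalars -/

section Adjacency

variable {F : Type u} [Field F]

theorem QAdjacent.symm {q μ ν : F} (h : QAdjacent q μ ν) : QAdjacent q ν μ :=
  ⟨h.1.symm, by linear_combination h.2⟩

/-- Vieta: `y` and `z` are the two roots of a monic quadratic with coefficients depending on `x`.
Hence a scalar has at most two neighbours, and chains satisfy a linear recurrence. -/
theorem QAdjacent.add_eq {q x y z : F} (hy : QAdjacent q x y) (hz : QAdjacent q x z)
    (hne : y ≠ z) : y + z = (q ^ 2 + q⁻¹ ^ 2) * x := by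
  apply mul_left_cancel₀ (sub_ne_zero.2 hne)
  linear_combination hy.2 - hz.2

theorem QAdjacent.eq_or_eq {q x y z w : F} (hy : QAdjacent q x y) (hz : QAdjacent q x z)
    (hw : QAdjacent q x w) (hne : y ≠ z) : w = y ∨ w = z := by
  by_contra! h
  have h1 := hy.add_eq hz hne
  have h2 := hy.add_eq hw h.1.symm
  exact h.2 (by linear_combination h2 - h1)

/-- Injective sequences of consecutively adjacent scalars. -/
def IsAdjacentChain (q : F) {d : ℕ} (θ : Fin (d + 1) → F) : Prop :=
  Function.Injective θ ∧ ∀ k : Fin d, QAdjacent q (θ k.castSucc) (θ k.succ)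

variable {q : F} {d : ℕ} {θ : Fin (d + 1) → F}

theorem IsAdjacentChain.adj (hθ : IsAdjacentChain q θ) {i : ℕ} (hi : i + 1 < d + 1) :
    QAdjacent q (θ ⟨i, by omega⟩) (θ ⟨i + 1, hi⟩) :=
  hθ.2 ⟨i, by omega⟩

theorem IsAdjacentChain.closed_form (hq0 : q ≠ 0) (h2 : q ^ 2 - q⁻¹ ^ 2 ≠ 0)
    (hθ : IsAdjacentChain q θ) (hd : 1 < d + 1) :
    ∃ a : F, a ≠ 0 ∧ ∀ (i : ℕ) (hi : i < d + 1),
      θ ⟨i, hi⟩ = a * q ^ (2 * i) + a⁻¹ * q⁻¹ ^ (2 * i) := by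
  set x := θ ⟨0, by omega⟩ with hx
  set y := θ ⟨1, hd⟩ with hy
  have hxy : x ^ 2 - (q ^ 2 + q⁻¹ ^ 2) * x * y + y ^ 2 + (q ^ 2 - q⁻¹ ^ 2) ^ 2 = 0 :=
    (hθ.adj (i := 0) hd).2
  have hqq : q * q⁻¹ = 1 := mul_inv_cancel₀ hq0
  set p := q⁻¹ with hp
  set s := (q ^ 2 - p ^ 2)⁻¹ with hs
  have hss : s * (q ^ 2 - p ^ 2) = 1 := inv_mul_cancel₀ h2
  -- The two coefficients come from solving `a + b = x`, `a q² + b q⁻² = y`; adjacency of `x` and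
  -- `y` then says precisely that `a b = 1`.
  have hab : (s * (y - p ^ 2 * x)) * (s * (q ^ 2 * x - y)) = 1 := by
    linear_combination -s ^ 2 * hxy + (s * (q ^ 2 - p ^ 2) + 1) * hss
      - s ^ 2 * (q * p + 1) * x ^ 2 * hqq
  refine ⟨s * (y - p ^ 2 * x), left_ne_zero_of_mul_eq_one hab, ?_⟩
  rw [inv_eq_of_mul_eq_one_right hab]
  suffices h : ∀ i : ℕ, (∀ hi : i < d + 1, θ ⟨i, hi⟩ = s * (y - p ^ 2 * x) * q ^ (2 * i) +
      s * (q ^ 2 * x - y) * p ^ (2 * i)) ∧ (∀ hi : i + 1 < d + 1, θ ⟨i + 1, hi⟩ =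
      s * (y - p ^ 2 * x) * q ^ (2 * (i + 1)) + s * (q ^ 2 * x - y) * p ^ (2 * (i + 1))) from
    fun i => (h i).1
  intro i
  induction i with
  | zero =>
    refine ⟨fun _ => ?_, fun _ => ?_⟩
    · rw [← hx]; linear_combination -x * hss
    · simp only [zero_add]; rw [← hy]
      linear_combination -y * hss
  | succ i ih =>
    refine ⟨ih.2, fun hi => ?_⟩
    have h1 := (hθ.adj (i := i) (by omega)).symm.add_eq (hθ.adj hi)
      (hθ.1.ne (by simp only [ne_eq, Fin.mk.injEq]; omega))
    rw [ih.1 (by omega), ih.2 (by omega)] at h1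
    rw [show 2 * (i + 1 + 1) = 2 * i + 4 by ring, pow_add, pow_add]
    rw [show 2 * (i + 1) = 2 * i + 2 by ring, pow_add, pow_add] at h1
    linear_combination h1 + (s * (y - p ^ 2 * x) * q ^ (2 * i) +
      s * (q ^ 2 * x - y) * p ^ (2 * i)) * (q * p + 1) * hqq

/-- If one of the two members is interior, it would have a third neighbour. If both are ends, the
chain would close into a cycle, and the closed form forbids this. -/
theorem IsAdjacentChain.not_adj (hq0 : q ≠ 0) (hq : ∀ n : ℕ, 0 < n → q ^ n ≠ 1)
    (hθ : IsAdjacentChain q θ) {i j : ℕ} (hij : i + 1 < j) (hj : j < d + 1) :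
    ¬ QAdjacent q (θ ⟨i, by omega⟩) (θ ⟨j, hj⟩) := by
  intro h
  have hne : ∀ {k l : ℕ} (hk : k < d + 1) (hl : l < d + 1), k ≠ l → θ ⟨k, hk⟩ ≠ θ ⟨l, hl⟩ :=
    fun hk hl hkl => hθ.1.ne (by simpa using hkl)
  rcases Nat.eq_zero_or_pos i with rfl | hi
  · by_cases hjd : j + 1 < d + 1
    · obtain ⟨j, rfl⟩ := Nat.exists_eq_add_of_lt hij
      rcases (hθ.adj (i := 0 + 1 + j) (by omega)).symm.eq_or_eq (hθ.adj hjd) h.symm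
        (hne _ _ (by omega)) with h' | h'
      · exact hne _ _ (by omega) h'
      · exact hne _ _ (by omega) h'
    · obtain ⟨a, ha, hform⟩ := hθ.closed_form hq0
        (sub_inv_pow_ne_zero hq0 hq (by norm_num)) (by omega)
      have hsum := (hθ.adj (i := 0) (by omega)).add_eq h (hne _ _ (by omega))
      obtain ⟨m, rfl⟩ := Nat.exists_eq_add_of_lt hij
      have hrep := hne (k := 0 + 1 + m) (l := 0) (by omega) (by omega) (by omega)
      rw [hform, hform, hform] at hsum
      rw [hform, hform] at hrep
      have hq2 := hq (2 * (m + 3)) (by omega)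
      rw [show 2 * (0 + 1 + m + 1) = 2 * m + 4 by ring] at hsum
      rw [show 2 * (0 + 1 + m) = 2 * m + 2 by ring] at hrep
      rw [show 2 * (m + 3) = 2 * m + 6 by ring] at hq2
      simp only [pow_add _ (2 * m), mul_zero, pow_zero, zero_add, mul_one] at hsum hrep hq2
      have hz : q ^ (2 * m) * q⁻¹ ^ (2 * m) = 1 := by
        rw [← mul_pow, mul_inv_cancel₀ hq0, one_pow]
      generalize q ^ (2 * m) = z at *
      generalize q⁻¹ ^ (2 * m) = z' at *
      have hz0 : z ≠ 0 := left_ne_zero_of_mul_eq_one hz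
      obtain rfl : z' = z⁻¹ := eq_inv_of_mul_eq_one_right hz
      -- With `j = m + 2` the last index, the first factor vanishes only if `q^(2(j+1)) = 1`, and
      -- the second only if `θ_{j-1} = θ_0`.
      have hfac : (z * q ^ 6 - 1) * (a ^ 2 * z * q ^ 2 - 1) = 0 := by
        field_simp at hsum
        linear_combination hsum
      rcases mul_eq_zero.1 hfac with h' | h'
      · exact hq2 (sub_eq_zero.1 h')
      · apply hrep
        field_simp
        linear_combination (z * q ^ 2 - 1) * h'
  · obtain ⟨i, rfl⟩ := Nat.exists_eq_succ_of_ne_zero hi.ne'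
    rcases (hθ.adj (i := i) (by omega)).symm.eq_or_eq (hθ.adj (i := i + 1) (by omega)) h
      (hne _ _ (by omega)) with h' | h'
    · exact hne _ _ (by omega) h'
    · exact hne _ _ (by omega) h'

/-- In a chain only consecutive members are adjacent. -/
theorem IsAdjacentChain.le_of_adj (hq0 : q ≠ 0) (hq : ∀ n : ℕ, 0 < n → q ^ n ≠ 1)
    (hθ : IsAdjacentChain q θ) {i j : Fin (d + 1)} (h : QAdjacent q (θ i) (θ j)) :
    (j : ℕ) ≤ i + 1 ∧ (i : ℕ) ≤ j + 1 := by
  by_contra! hlt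
  by_cases hc : (j : ℕ) ≤ i + 1
  · exact hθ.not_adj hq0 hq (hlt hc) i.2 h.symm
  · exact hθ.not_adj hq0 hq (not_le.1 hc) j.2 h

end Adjacency

/-! ### Tridiagonal pairs from the `q`-Dolan/Grady relations -/

section DolanGradyAction

variable {F : Type u} [Field F] {V : Type v} [AddCommGroup V] [Module F V]
  {S T : Module.End F V} {q : F}

/-- Applying `E_ν` to the first relation at `v` turns every `S` left of `T` into `ν` and every `S`
right of it into `μ`. What remains is a scalar times `E_ν T v`, and that scalar is `ν - μ` times the
adjacency quadratic. -/
theorem eq_or_adj_of_eigenProj_ne_zero (hq0 : q ≠ 0) (hS : IsDiag S)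
    (h : IsDolanGradyPair q S T) {μ ν : F} {v : V} (hv : v ∈ S.eigenspace μ)
    (hne : eigenProj hS ν (T v) ≠ 0) : ν = μ ∨ QAdjacent q μ ν := by
  have hSv : S v = μ • v := Module.End.mem_eigenspace_iff.1 hv
  have h1 := congrArg (eigenProj hS ν) (LinearMap.congr_fun h.first v)
  rw [lie_qComm_qComm hq0] at h1
  simp only [Ring.lie_def, LinearMap.sub_apply, LinearMap.add_apply, LinearMap.smul_apply,
    Module.End.mul_apply, hSv, map_smul, map_sub, map_add, eigenProj_apply_map, smul_smul,
    ← sub_smul, ← add_smul] at h1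
  rw [← sub_eq_zero, ← sub_smul, smul_eq_zero, or_iff_left hne] at h1
  rw [or_iff_not_imp_left]
  intro hνμ
  refine ⟨Ne.symm hνμ, mul_left_cancel₀ (sub_ne_zero.2 hνμ) ?_⟩
  linear_combination h1

theorem map_eigenspace_le (hq0 : q ≠ 0) (hq : ∀ n : ℕ, 0 < n → q ^ n ≠ 1) (hS : IsDiag S)
    (h : IsDolanGradyPair q S T) {d : ℕ} {θ : Fin (d + 1) → F} (hθ : IsStandardOrdering q S θ)
    (i : Fin (d + 1)) : (S.eigenspace (θ i)).map T ≤
      ⨆ j : Fin (d + 1), ⨆ _ : (j : ℕ) ≤ i + 1 ∧ (i : ℕ) ≤ j + 1, S.eigenspace (θ j) := by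
  have hc : IsAdjacentChain q θ := ⟨hθ.1.1, hθ.2⟩
  rintro _ ⟨v, hv, rfl⟩
  rw [← hθ.1.sum_eigenProj hS (T v)]
  refine Submodule.sum_mem _ fun j _ => ?_
  by_cases h0 : eigenProj hS (θ j) (T v) = 0
  · rw [h0]; exact Submodule.zero_mem _
  have hij : (j : ℕ) ≤ i + 1 ∧ (i : ℕ) ≤ j + 1 := by
    rcases eq_or_adj_of_eigenProj_ne_zero hq0 hS h hv h0 with h' | h'
    · rw [hθ.1.1 h']; omega
    · exact hc.le_of_adj hq0 hq h'
  exact Submodule.mem_iSup_of_mem j (Submodule.mem_iSup_of_mem hij (eigenProj_mem hS _ _))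

theorem IsAdjacentChain.reverse {d : ℕ} {θ : Fin (d + 1) → F} (hθ : IsAdjacentChain q θ) :
    IsAdjacentChain q (θ ∘ Fin.rev) := by
  refine ⟨hθ.1.comp Fin.rev_injective, fun k => ?_⟩
  have := (hθ.2 k.rev).symm
  simpa [Fin.rev_castSucc, Fin.rev_succ] using this

theorem IsAdjacentChain.cons {d : ℕ} {θ : Fin (d + 1) → F} (hθ : IsAdjacentChain q θ) {ν : F}
    (hν : ν ∉ Set.range θ) (hadj : QAdjacent q ν (θ 0)) :
    IsAdjacentChain q (Fin.cons ν θ : Fin (d + 1 + 1) → F) := by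
  refine ⟨Fin.cons_injective_iff.2 ⟨hν, hθ.1⟩, fun k => ?_⟩
  refine Fin.cases ?_ (fun k => ?_) k
  · simpa using hadj
  · rw [← Fin.succ_castSucc, Fin.cons_succ, Fin.cons_succ]
    exact hθ.2 k

/-- In a longest chain of eigenvalues no further eigenvalue can be adjacent to a member, so the sum
of the corresponding eigenspaces is invariant and, by irreducibility, is all of `V`. -/
theorem exists_standardOrdering [FiniteDimensional F V] [Nontrivial V] (hq0 : q ≠ 0)
    (hS : IsDiag S) (h : IsDolanGradyPair q S T)
    (hirr : ∀ W : Submodule F V, W.map S ≤ W → W.map T ≤ W → W = ⊥ ∨ W = ⊤) :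
    ∃ (d : ℕ) (θ : Fin (d + 1) → F), IsStandardOrdering q S θ := by
  classical
  have hfin : Set.Finite {μ | S.HasEigenvalue μ} := Module.End.finite_hasEigenvalue S
  obtain ⟨μ₀, hμ₀⟩ : ∃ μ, S.HasEigenvalue μ := by
    by_contra! hno
    have htop : (⊤ : Submodule F V) = ⊥ := by
      rw [← show _ = _ from hS, iSup_eq_bot]
      intro μ
      by_contra hμ
      exact hno μ hμ
    exact top_ne_bot htop
  let P : ℕ → Prop := fun d => ∃ θ : Fin (d + 1) → F, IsAdjacentChain q θ ∧
    ∀ i, S.HasEigenvalue (θ i)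
  have hP0 : P 0 := ⟨fun _ => μ₀, ⟨fun i j _ => Fin.ext (by omega), fun k => k.elim0⟩,
    fun _ => hμ₀⟩
  have hbound : ∀ d, P d → d ≤ hfin.toFinset.card := by
    rintro d ⟨θ, hθ, hev⟩
    have := Finset.card_le_card_of_injOn (s := (Finset.univ : Finset (Fin (d + 1))))
      (t := hfin.toFinset) θ (fun i _ => by simpa using hev i) hθ.1.injOn
    rw [Finset.card_univ, Fintype.card_fin] at this
    omega
  set d := Nat.findGreatest P hfin.toFinset.card with hd
  obtain ⟨θ, hθ, hev⟩ : P d := Nat.findGreatest_spec (Nat.zero_le _) hP0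
  have hmax : ¬ P (d + 1) := fun hP =>
    absurd (Nat.le_findGreatest (hbound _ hP) hP) (by omega)
  refine ⟨d, θ, ⟨hθ.1, ?_⟩, hθ.2⟩
  refine Set.Subset.antisymm (by rintro _ ⟨i, rfl⟩; exact hev i) fun μ hμ => ?_
  by_contra hμθ
  -- Interior members already have their two neighbours in the chain; a new neighbour of an end
  -- would lengthen it, after reversal when the end is the last one.
  have hstep : ∀ (i : Fin (d + 1)) (ν : F), S.HasEigenvalue ν → QAdjacent q (θ i) ν →
      ν ∈ Set.range θ := by
    intro i ν hν hadj
    by_contra hνθ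
    rcases Nat.eq_zero_or_pos i with hi | hi
    · have hi0 : i = 0 := Fin.ext hi
      refine hmax ⟨Fin.cons ν θ, hθ.cons hνθ (hi0 ▸ hadj.symm), fun j => ?_⟩
      refine Fin.cases ?_ (fun j => ?_) j
      · simpa using hν
      · simpa using hev j
    · by_cases hid : (i : ℕ) + 1 < d + 1
      · obtain ⟨m, hm⟩ := Nat.exists_eq_succ_of_ne_zero hi.ne'
        have him : i = ⟨m + 1, by omega⟩ := Fin.ext hm
        rw [him] at hadj
        rcases (hθ.adj (i := m) (by omega)).symm.eq_or_eq (hθ.adj (i := m + 1) (by omega)) hadj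
          (hθ.1.ne (by simp only [ne_eq, Fin.mk.injEq]; omega)) with h' | h'
        · exact hνθ ⟨_, h'.symm⟩
        · exact hνθ ⟨_, h'.symm⟩
      · have hrev : (θ ∘ Fin.rev) 0 = θ i := by
          refine congrArg θ (Fin.ext ?_)
          simp only [Fin.val_rev, Fin.val_zero]
          omega
        have hνr : ν ∉ Set.range (θ ∘ Fin.rev) := by
          rintro ⟨j, hj⟩
          exact hνθ ⟨_, hj⟩
        refine hmax ⟨Fin.cons ν (θ ∘ Fin.rev), hθ.reverse.cons hνr (hrev ▸ hadj.symm),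
          fun j => ?_⟩
        refine Fin.cases ?_ (fun j => ?_) j
        · simpa using hν
        · simpa using hev _
  set W : Submodule F V := ⨆ i, S.eigenspace (θ i) with hW
  have hWS : W.map S ≤ W := by
    rw [hW, Submodule.map_iSup]
    refine iSup_mono fun i => ?_
    rintro _ ⟨v, hv, rfl⟩
    rw [Module.End.mem_eigenspace_iff.1 hv]
    exact Submodule.smul_mem _ _ hv
  have hWT : W.map T ≤ W := by
    conv_lhs => rw [hW, Submodule.map_iSup]
    refine iSup_le fun i => ?_
    rintro _ ⟨v, hv, rfl⟩
    rw [← sum_eigenProj hS (s := hfin.toFinset) (fun ν hν => by simpa using hν) (T v)]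
    refine Submodule.sum_mem _ fun ν hν => ?_
    by_cases h0 : eigenProj hS ν (T v) = 0
    · rw [h0]; exact Submodule.zero_mem _
    have hmem : ν ∈ Set.range θ := by
      rcases eq_or_adj_of_eigenProj_ne_zero hq0 hS h hv h0 with h' | h'
      · exact ⟨i, h'.symm⟩
      · exact hstep i ν (by simpa using hν) h'
    obtain ⟨j, rfl⟩ := hmem
    exact Submodule.mem_iSup_of_mem j (eigenProj_mem hS _ _)
  rcases hirr W hWS hWT with hbot | htop
  · exact hev 0 (le_bot_iff.1 (hbot ▸ le_iSup (fun i => S.eigenspace (θ i)) 0))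
  · obtain ⟨v, hv, hv0⟩ := hμ.exists_hasEigenvector
    refine hv0 ?_
    -- An eigenvalue missed by the chain would have a projection that vanishes on all of `V`.
    have hker : (⊤ : Submodule F V) ≤ LinearMap.ker (eigenProj hS μ) := by
      rw [← htop]
      refine iSup_le fun i w hw => ?_
      exact eigenProj_of_mem_ne hS (fun he => hμθ ⟨i, he⟩) hw
    rw [← eigenProj_of_mem hS hv]
    exact hker trivial

theorem isTridiagonalPair_of_dolanGrady [FiniteDimensional F V] [Nontrivial V] (hq0 : q ≠ 0)
    (hq : ∀ n : ℕ, 0 < n → q ^ n ≠ 1) (hS : IsDiag S) (hT : IsDiag T)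
    (h : IsDolanGradyPair q S T)
    (hirr : ∀ W : Submodule F V, W.map S ≤ W → W.map T ≤ W → W = ⊥ ∨ W = ⊤) :
    IsTridiagonalPair S T where
  nontrivial := inferInstance
  finiteDimensional := inferInstance
  diag_left := hS
  diag_right := hT
  right_on_left := by
    obtain ⟨d, θ, hθ⟩ := exists_standardOrdering hq0 hS h hirr
    exact ⟨d, θ, hθ.1, map_eigenspace_le hq0 hq hS h hθ⟩
  left_on_right := by
    obtain ⟨d, θ, hθ⟩ := exists_standardOrdering hq0 hT h.swap fun W h1 h2 => hirr W h2 h1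
    exact ⟨d, θ, hθ.1, map_eigenspace_le hq0 hq hT h.swap hθ⟩
  irreducible := hirr

end DolanGradyAction

/-! ### Transport of tridiagonal pairs along linear equivalences -/

section Transport

variable {F : Type u} [Field F] {V : Type v} [AddCommGroup V] [Module F V]
  {V' : Type w} [AddCommGroup V'] [Module F V']

theorem eigenspace_map_equiv (γ : V ≃ₗ[F] V') {S : Module.End F V} {S' : Module.End F V'}
    (h : ∀ v, γ (S v) = S' (γ v)) (μ : F) :
    (S.eigenspace μ).map (γ : V →ₗ[F] V') = S'.eigenspace μ := by
  ext w
  rw [Submodule.mem_map_equiv, Module.End.mem_eigenspace_iff, Module.End.mem_eigenspace_iff,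
    ← γ.injective.eq_iff, h, map_smul, γ.apply_symm_apply]

theorem IsDiag.of_equiv (γ : V ≃ₗ[F] V') {S : Module.End F V} {S' : Module.End F V'}
    (h : ∀ v, γ (S v) = S' (γ v)) (hS : IsDiag S) : IsDiag S' := by
  unfold IsDiag
  simp_rw [← eigenspace_map_equiv γ h]
  rw [← Submodule.map_iSup, show _ = _ from hS, Submodule.map_top, LinearEquiv.range]

theorem IsEigenvalueOrdering.of_equiv (γ : V ≃ₗ[F] V') {S : Module.End F V}
    {S' : Module.End F V'} (h : ∀ v, γ (S v) = S' (γ v)) {d : ℕ} {θ : Fin (d + 1) → F}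
    (hθ : IsEigenvalueOrdering S θ) : IsEigenvalueOrdering S' θ := by
  refine ⟨hθ.1, hθ.2.trans (Set.ext fun μ => ?_)⟩
  rw [Set.mem_ofPred_eq, Set.mem_ofPred_eq, Module.End.hasEigenvalue_iff,
    Module.End.hasEigenvalue_iff, ← eigenspace_map_equiv γ h, ne_eq, ne_eq,
    Submodule.map_eq_bot_iff]

theorem ActsTridiagonally.of_equiv (γ : V ≃ₗ[F] V') {S T : Module.End F V}
    {S' T' : Module.End F V'} (hS : ∀ v, γ (S v) = S' (γ v)) (hT : ∀ v, γ (T v) = T' (γ v))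
    (h : ActsTridiagonally S T) : ActsTridiagonally S' T' := by
  obtain ⟨d, θ, hθ, hmap⟩ := h
  refine ⟨d, θ, hθ.of_equiv γ hS, fun i => ?_⟩
  simp_rw [← eigenspace_map_equiv γ hS, ← Submodule.map_iSup]
  rintro _ ⟨_, ⟨v, hv, rfl⟩, rfl⟩
  exact ⟨T v, hmap i ⟨v, hv, rfl⟩, hT v⟩

theorem IsTridiagonalPair.of_equiv (γ : V ≃ₗ[F] V') {S T : Module.End F V}
    {S' T' : Module.End F V'} (hS : ∀ v, γ (S v) = S' (γ v)) (hT : ∀ v, γ (T v) = T' (γ v))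
    (h : IsTridiagonalPair S T) : IsTridiagonalPair S' T' where
  nontrivial := by
    have := h.nontrivial
    exact γ.symm.toEquiv.nontrivial
  finiteDimensional := by
    have := h.finiteDimensional
    exact Module.Finite.equiv γ
  diag_left := h.diag_left.of_equiv γ hS
  diag_right := h.diag_right.of_equiv γ hT
  right_on_left := h.right_on_left.of_equiv γ hS hT
  left_on_right := h.left_on_right.of_equiv γ hT hS
  irreducible := by
    intro W h1 h2
    have hinv : ∀ {X : Module.End F V} {X' : Module.End F V'}, (∀ v, γ (X v) = X' (γ v)) →
        W.map X' ≤ W → (W.comap (γ : V →ₗ[F] V')).map X ≤ W.comap (γ : V →ₗ[F] V') := by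
      rintro X X' hX hW _ ⟨v, hv, rfl⟩
      change γ (X v) ∈ W
      rw [hX]
      exact hW ⟨γ v, hv, rfl⟩
    have hback : (W.comap (γ : V →ₗ[F] V')).map (γ : V →ₗ[F] V') = W :=
      Submodule.map_comap_eq_of_surjective γ.surjective W
    rcases h.irreducible _ (hinv hS h1) (hinv hT h2) with h0 | h0
    · left; rw [← hback, h0, Submodule.map_bot]
    · right; rw [← hback, h0, Submodule.map_top, LinearEquiv.range]

end Transport

/-! ### The map `H` and its commutation with the generators -/

section MapH

variable {F : Type u} [Field F] {q : F}

theorem tPair_self (μ : F) : tPair q μ μ = 1 := by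
  simp [tPair]

/-- This is `lusztigPoly_mul_swap` evaluated at adjacent scalars, where `dolanGradyPoly` vanishes.
-/
theorem tPair_mul_swap (h12 : (q - q⁻¹) * (q ^ 2 - q⁻¹ ^ 2) ≠ 0) (hq0 : q ≠ 0) {μ ν : F}
    (h : QAdjacent q μ ν) : tPair q μ ν * tPair q ν μ = 1 := by
  have h1 := left_ne_zero_of_mul h12
  have h2 := right_ne_zero_of_mul h12
  have hdg : dolanGradyPoly q q⁻¹ μ ν = 0 := by
    unfold dolanGradyPoly
    rw [mul_inv_cancel₀ hq0]
    linear_combination (μ - ν) * h.2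
  have hl : (q - q⁻¹) * (q ^ 2 - q⁻¹ ^ 2) * tPair q μ ν = lusztigPoly q q⁻¹ μ ν := by
    unfold tPair lusztigPoly
    generalize q⁻¹ = p at *
    field_simp
  have hr : (q - q⁻¹) * (q ^ 2 - q⁻¹ ^ 2) * tPair q ν μ = lusztigPoly q⁻¹ q μ ν := by
    unfold tPair lusztigPoly
    generalize q⁻¹ = p at *
    field_simp
    ring
  have hmul := lusztigPoly_mul_swap q q⁻¹ μ ν
  rw [hdg, ← hl, ← hr] at hmul
  apply mul_left_cancel₀ (pow_ne_zero 2 h12)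
  linear_combination hmul

theorem tCoeff_succ {d : ℕ} (θ : Fin (d + 1) → F) (k : Fin d) :
    tCoeff q θ k.succ = tCoeff q θ k.castSucc * tPair q (θ k.castSucc) (θ k.succ) := by
  have h : tPair q (θ k.castSucc) (θ k.succ) =
      ∏ l : Fin d, if l = k then tPair q (θ l.castSucc) (θ l.succ) else 1 := by
    rw [Finset.prod_ite_eq' Finset.univ k]; simp
  rw [h, tCoeff, tCoeff, ← Finset.prod_mul_distrib]
  refine Finset.prod_congr rfl fun l _ => ?_
  simp only [Fin.val_succ, Fin.val_castSucc, Fin.ext_iff]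
  by_cases h1 : (l : ℕ) < k
  · simp [h1, h1.ne, h1.trans (Nat.lt_succ_self _)]
  · by_cases h2 : (l : ℕ) = k
    · simp [h2]
    · simp [h1, h2, show ¬ (l : ℕ) < k + 1 by omega]

theorem tCoeff_ne_zero (h12 : (q - q⁻¹) * (q ^ 2 - q⁻¹ ^ 2) ≠ 0) (hq0 : q ≠ 0) {d : ℕ}
    {θ : Fin (d + 1) → F} (hθ : ∀ k : Fin d, QAdjacent q (θ k.castSucc) (θ k.succ))
    (i : Fin (d + 1)) : tCoeff q θ i ≠ 0 := by
  refine Finset.prod_ne_zero_iff.2 fun k _ => ?_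
  split_ifs
  · exact left_ne_zero_of_mul_eq_one (tPair_mul_swap h12 hq0 (hθ k))
  · exact one_ne_zero

/-- For `i = j + 1` this is the recursion for `t_i`; for `j = i + 1` the last factor of `t_j`
cancels against its swap. -/
theorem tCoeff_mul_tPair (h12 : (q - q⁻¹) * (q ^ 2 - q⁻¹ ^ 2) ≠ 0) (hq0 : q ≠ 0) {d : ℕ}
    {θ : Fin (d + 1) → F} (hθ : ∀ k : Fin d, QAdjacent q (θ k.castSucc) (θ k.succ))
    {i j : Fin (d + 1)} (hij : (j : ℕ) ≤ i + 1 ∧ (i : ℕ) ≤ j + 1) :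
    tCoeff q θ j * tPair q (θ j) (θ i) = tCoeff q θ i := by
  rcases lt_trichotomy (i : ℕ) j with hlt | heq | hlt
  · obtain ⟨k, rfl, rfl⟩ : ∃ k : Fin d, i = k.castSucc ∧ j = k.succ :=
      ⟨⟨i, by omega⟩, rfl, Fin.ext (by simp only [Fin.succ_mk]; omega)⟩
    rw [tCoeff_succ, mul_assoc, tPair_mul_swap h12 hq0 (hθ _), mul_one]
  · rw [Fin.ext heq, tPair_self, mul_one]
  · obtain ⟨k, rfl, rfl⟩ : ∃ k : Fin d, j = k.castSucc ∧ i = k.succ :=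
      ⟨⟨j, by omega⟩, rfl, Fin.ext (by simp only [Fin.succ_mk]; omega)⟩
    rw [tCoeff_succ]

variable {V : Type v} [AddCommGroup V] [Module F V] {S T : Module.End F V}

theorem mapH_apply_of_mem (hS : IsDiag S) {d : ℕ} {θ : Fin (d + 1) → F}
    (hθ : Function.Injective θ) {i : Fin (d + 1)} {v : V} (hv : v ∈ S.eigenspace (θ i)) :
    mapH q hS θ v = tCoeff q θ i • v := by
  rw [mapH, LinearMap.sum_apply, Finset.sum_eq_single_of_mem i (Finset.mem_univ i),
    LinearMap.smul_apply, eigenProj_of_mem hS hv]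
  intro j _ hji
  rw [LinearMap.smul_apply, eigenProj_of_mem_ne hS (hθ.ne hji.symm) hv, smul_zero]

/-- Two maps that agree on the eigenspaces listed in an ordering are equal. -/
theorem IsEigenvalueOrdering.hom_ext {W : Type w} [AddCommGroup W] [Module F W] (hS : IsDiag S)
    {d : ℕ} {θ : Fin (d + 1) → F} (hθ : IsEigenvalueOrdering S θ) {f g : V →ₗ[F] W}
    (h : ∀ i, ∀ v ∈ S.eigenspace (θ i), f v = g v) : f = g := by
  ext v
  rw [← hθ.sum_eigenProj hS v, map_sum, map_sum]
  exact Finset.sum_congr rfl fun i _ => h i _ (eigenProj_mem hS _ _)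

theorem mapH_comm (hS : IsDiag S) {d : ℕ} {θ : Fin (d + 1) → F}
    (hθ : IsEigenvalueOrdering S θ) : mapH q hS θ ∘ₗ S = S ∘ₗ mapH q hS θ := by
  refine hθ.hom_ext hS fun i v hv => ?_
  rw [LinearMap.comp_apply, LinearMap.comp_apply, mapH_apply_of_mem hS hθ.1 hv,
    Module.End.mem_eigenspace_iff.1 hv, map_smul, mapH_apply_of_mem hS hθ.1 hv, map_smul,
    Module.End.mem_eigenspace_iff.1 hv, smul_comm]

theorem mapH_bijective [FiniteDimensional F V] (h12 : (q - q⁻¹) * (q ^ 2 - q⁻¹ ^ 2) ≠ 0)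
    (hq0 : q ≠ 0) (hS : IsDiag S) {d : ℕ} {θ : Fin (d + 1) → F}
    (hθ : IsStandardOrdering q S θ) : Function.Bijective (mapH q hS θ) := by
  have hsurj : Function.Surjective (mapH q hS θ) := by
    intro v
    refine ⟨∑ i, (tCoeff q θ i)⁻¹ • eigenProj hS (θ i) v, ?_⟩
    rw [map_sum]
    refine Eq.trans (Finset.sum_congr rfl fun i _ => ?_) (hθ.1.sum_eigenProj hS v)
    rw [map_smul, mapH_apply_of_mem hS hθ.1.1 (eigenProj_mem hS _ _), smul_smul,
      inv_mul_cancel₀ (tCoeff_ne_zero h12 hq0 hθ.2 i), one_smul]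
  exact ⟨LinearMap.injective_iff_surjective.2 hsurj, hsurj⟩

theorem mapH_lusztigElt (hq0 : q ≠ 0) (hq : ∀ n : ℕ, 0 < n → q ^ n ≠ 1) (hS : IsDiag S)
    (h : IsDolanGradyPair q S T) {d : ℕ} {θ : Fin (d + 1) → F}
    (hθ : IsStandardOrdering q S θ) :
    mapH q hS θ ∘ₗ lusztigElt q S T = T ∘ₗ mapH q hS θ := by
  have h1 := sub_inv_pow_ne_zero hq0 hq (n := 1) (by norm_num)
  have h2 := sub_inv_pow_ne_zero hq0 hq (n := 2) (by norm_num)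
  rw [pow_one, pow_one] at h1
  have h12 := mul_ne_zero h1 h2
  refine hθ.1.hom_ext hS fun i v hv => ?_
  have hSv := Module.End.mem_eigenspace_iff.1 hv
  set c := ((q - q⁻¹) * (q ^ 2 - q⁻¹ ^ 2))⁻¹ with hc
  -- On a `θ_i`-eigenvector each `S` to the right of `T` becomes `θ_i`, so the Lusztig element acts
  -- as `T` followed by a polynomial in `S`, whose value on the `θ_j`-eigenspace is `t_{ji}`.
  let τ : Module.End F V := 1 + c • ((S - θ i • 1) * (q • S - (q⁻¹ * θ i) • 1))
  have hτ : lusztigElt q S T v = τ (T v) := by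
    simp only [lusztigElt, ← hc, qComm, Ring.lie_def, τ, LinearMap.sub_apply, LinearMap.add_apply,
      LinearMap.smul_apply, Module.End.mul_apply, Module.End.one_apply, hSv, map_smul, map_sub]
    module
  rw [LinearMap.comp_apply, LinearMap.comp_apply, hτ, mapH_apply_of_mem hS hθ.1.1 hv, map_smul]
  have hle : ⨆ j : Fin (d + 1), ⨆ _ : (j : ℕ) ≤ i + 1 ∧ (i : ℕ) ≤ j + 1, S.eigenspace (θ j) ≤
      LinearMap.eqLocus (mapH q hS θ ∘ₗ τ) (tCoeff q θ i • LinearMap.id) := by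
    refine iSup₂_le fun j hij w hw => ?_
    have hSw := Module.End.mem_eigenspace_iff.1 hw
    have hτw : τ w = tPair q (θ j) (θ i) • w := by
      simp only [τ, LinearMap.sub_apply, LinearMap.add_apply, LinearMap.smul_apply,
        Module.End.mul_apply, Module.End.one_apply, hSw, map_smul, smul_smul, ← sub_smul]
      rw [← sub_eq_zero]
      have hcoef : tPair q (θ j) (θ i) =
          1 + c * ((θ j - θ i) * (q * θ j - q⁻¹ * θ i)) := by
        rw [tPair, hc, mul_inv, div_mul_div_comm, div_eq_inv_mul, mul_inv]
      rw [hcoef]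
      module
    change mapH q hS θ (τ w) = tCoeff q θ i • w
    rw [hτw, map_smul, mapH_apply_of_mem hS hθ.1.1 hw, smul_smul, mul_comm,
      tCoeff_mul_tPair h12 hq0 hθ.2 hij]
  -- Tridiagonality confines `T v` to the eigenspaces with `|i - j| ≤ 1`, where `t_j t_{ji} = t_i`
  -- is available.
  exact hle (map_eigenspace_le hq0 hq hS h hθ i ⟨v, hv, rfl⟩)

end MapH

/-! ### From intertwiners to isomorphisms of modules and tridiagonal pairs -/

section ModuleAction

variable {F : Type u} [Field F] {q : F} (V : Type v) [AddCommGroup V] [Module F V]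
  [Module (QOnsager q) V] [IsScalarTower F (QOnsager q) V]

theorem isDolanGradyPair_actOn :
    IsDolanGradyPair q (actOn V (genA q) : Module.End F V) (actOn V (genAstar q)) :=
  (isDolanGradyPair_gen q).map (Algebra.lsmul F F V)

theorem actOn_irreducible [IsSimpleModule (QOnsager q) V] (W : Submodule F V)
    (h1 : W.map (actOn V (genA q)) ≤ W) (h2 : W.map (actOn V (genAstar q)) ≤ W) :
    W = ⊥ ∨ W = ⊤ := by
  have hinv : ∀ ξ : QOnsager q, ∀ w ∈ W, ξ • w ∈ W := by
    intro ξ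
    induction ξ using QOnsager.induction with
    | hA => exact fun w hw => h1 ⟨w, hw, rfl⟩
    | hB => exact fun w hw => h2 ⟨w, hw, rfl⟩
    | hs c => exact fun w hw => by rw [algebraMap_smul]; exact W.smul_mem c hw
    | hadd x y hx hy => exact fun w hw => by rw [add_smul]; exact W.add_mem (hx w hw) (hy w hw)
    | hmul x y hx hy => exact fun w hw => by rw [mul_smul]; exact hx _ (hy w hw)
  let W' : Submodule (QOnsager q) V :=
    { W.toAddSubmonoid with smul_mem' := fun ξ w hw => hinv ξ w hw }
  have hW : W = W'.restrictScalars F := rfl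
  rcases eq_bot_or_eq_top W' with h | h
  · left; rw [hW, h, Submodule.restrictScalars_bot]
  · right; rw [hW, h, Submodule.restrictScalars_top]

variable {V}

/-- A linear map that intertwines the generators with their images under an automorphism
intertwines all of `O_q`. -/
theorem intertwines_of_gen (L : QOnsager q ≃ₐ[F] QOnsager q) {H : Module.End F V}
    (hA : ∀ v, H (L (genA q) • v) = genA q • H v)
    (hB : ∀ v, H (L (genAstar q) • v) = genAstar q • H v) (ξ : QOnsager q) (v : V) :
    H (L ξ • v) = ξ • H v := by
  induction ξ using QOnsager.induction generalizing v with
  | hA => exact hA v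
  | hB => exact hB v
  | hs c => rw [AlgEquiv.commutes, algebraMap_smul, algebraMap_smul, map_smul]
  | hadd x y hx hy => rw [map_add, add_smul, add_smul, map_add, hx, hy]
  | hmul x y hx hy => rw [map_mul, mul_smul, mul_smul, hx, hy]

/-- An intertwiner as an isomorphism from `V` to `V` twisted via `L`. -/
noncomputable def twistEquiv (L : QOnsager q ≃ₐ[F] QOnsager q) {H : Module.End F V}
    (hbij : Function.Bijective H) (hH : ∀ ξ v, H (L ξ • v) = ξ • H v) :
    V ≃ₗ[QOnsager q] Twist L V :=
  LinearEquiv.ofBijective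
    { toFun := fun x => Twist.of L (H x)
      map_add' := fun x y => by rw [map_add, map_add]
      map_smul' := fun ξ x => by
        rw [RingHom.id_apply, Twist.smul_of, ← hH, AlgEquiv.apply_symm_apply] }
    ((Twist.of L).bijective.comp hbij)

/-- An intertwiner as an isomorphism from `V` twisted via `L⁻¹` to `V`. -/
noncomputable def twistSymmEquiv (L : QOnsager q ≃ₐ[F] QOnsager q) {H : Module.End F V}
    (hbij : Function.Bijective H) (hH : ∀ ξ v, H (L ξ • v) = ξ • H v) :
    Twist L.symm V ≃ₗ[QOnsager q] V :=
  LinearEquiv.ofBijective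
    { toFun := fun x => H ((Twist.of L.symm).symm x)
      map_add' := fun x y => by rw [map_add, map_add]
      map_smul' := fun ξ x => by
        obtain ⟨y, rfl⟩ := (Twist.of L.symm).surjective x
        rw [RingHom.id_apply, Twist.smul_of, AddEquiv.symm_apply_apply, AddEquiv.symm_apply_apply,
          ← hH, AlgEquiv.symm_symm] }
    (hbij.comp (Twist.of L.symm).symm.bijective)

theorem IsTDIso.of_bijective {V : Type v} [AddCommGroup V] [Module F V] {V' : Type w}
    [AddCommGroup V'] [Module F V'] {γ : V →ₗ[F] V'} {S T : Module.End F V}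
    {S' T' : Module.End F V'} (h : IsTridiagonalPair S T) (hγ : Function.Bijective γ)
    (hS : ∀ v, γ (S v) = S' (γ v)) (hT : ∀ v, γ (T v) = T' (γ v)) : IsTDIso γ S T S' T' where
  source := h
  target := h.of_equiv (LinearEquiv.ofBijective γ hγ) hS hT
  bijective := hγ
  comm_left := LinearMap.ext hS
  comm_right := LinearMap.ext hT

theorem intertwines_symm {V : Type v} [AddCommGroup V] [Module F V] {V' : Type w}
    [AddCommGroup V'] [Module F V'] {γ : V →ₗ[F] V'} (hγ : Function.Bijective γ)
    {X : Module.End F V} {X' : Module.End F V'} (hX : ∀ v, γ (X v) = X' (γ v)) (v : V') :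
    (LinearEquiv.ofBijective γ hγ).symm (X' v) = X ((LinearEquiv.ofBijective γ hγ).symm v) := by
  obtain ⟨w, rfl⟩ := hγ.2 v
  rw [← hX, LinearEquiv.ofBijective_symm_apply_apply, LinearEquiv.ofBijective_symm_apply_apply]

theorem IsTDIso.symm {V : Type v} [AddCommGroup V] [Module F V] {V' : Type w}
    [AddCommGroup V'] [Module F V'] {γ : V →ₗ[F] V'} {S T : Module.End F V}
    {S' T' : Module.End F V'} (h : IsTDIso γ S T S' T') :
    IsTDIso ((LinearEquiv.ofBijective γ h.bijective).symm : V' →ₗ[F] V) S' T' S T :=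
  .of_bijective h.target (LinearEquiv.bijective _)
    (intertwines_symm h.bijective (LinearMap.congr_fun h.comm_left))
    (intertwines_symm h.bijective (LinearMap.congr_fun h.comm_right))

theorem IsTDIso.trans {V₁ V₂ V₃ : Type*} [AddCommGroup V₁] [Module F V₁] [AddCommGroup V₂]
    [Module F V₂] [AddCommGroup V₃] [Module F V₃] {γ : V₁ →ₗ[F] V₂} {δ : V₂ →ₗ[F] V₃}
    {S₁ T₁ : Module.End F V₁} {S₂ T₂ : Module.End F V₂} {S₃ T₃ : Module.End F V₃}
    (h : IsTDIso γ S₁ T₁ S₂ T₂) (h' : IsTDIso δ S₂ T₂ S₃ T₃) :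
    IsTDIso (δ ∘ₗ γ) S₁ T₁ S₃ T₃ where
  source := h.source
  target := h'.target
  bijective := h'.bijective.comp h.bijective
  comm_left := by
    rw [LinearMap.comp_assoc, h.comm_left, ← LinearMap.comp_assoc, h'.comm_left,
      LinearMap.comp_assoc]
  comm_right := by
    rw [LinearMap.comp_assoc, h.comm_right, ← LinearMap.comp_assoc, h'.comm_right,
      LinearMap.comp_assoc]

end ModuleAction

/-! ### The main theorem -/

theorem proposition3p10 {F : Type u} [Field F] (q : F) (hq0 : q ≠ 0)
    (hq : ∀ n : ℕ, 0 < n → q ^ n ≠ 1) :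
    -- the Lusztig automorphism exists and is unique
    (∃! L : QOnsager q ≃ₐ[F] QOnsager q, IsLusztig q L) ∧
    ∀ L : QOnsager q ≃ₐ[F] QOnsager q, IsLusztig q L →
    ∀ (V : Type v) [AddCommGroup V] [Module F V] [Module (QOnsager q) V]
      [IsScalarTower F (QOnsager q) V] [FiniteDimensional F V] [IsSimpleModule (QOnsager q) V],
    2 ≤ Module.finrank F V →
    ∀ (hA : IsDiag (actOn V (genA q) : Module.End F V)),
    IsDiag (actOn V (genAstar q) : Module.End F V) →
    -- isomorphic modules
    Nonempty (V ≃ₗ[QOnsager q] Twist L V) ∧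
    Nonempty (V ≃ₗ[QOnsager q] Twist L.symm V) ∧
    Nonempty (Twist L V ≃ₗ[QOnsager q] Twist L.symm V) ∧
    -- tridiagonal pairs
    IsTridiagonalPair (actOn V (genA q) : Module.End F V) (actOn V (genAstar q)) ∧
    IsTridiagonalPair (actOn V (genA q) : Module.End F V) (actOn V (L (genAstar q))) ∧
    IsTridiagonalPair (actOn V (genA q) : Module.End F V) (actOn V (L.symm (genAstar q))) ∧
    -- isomorphic tridiagonal pairs
    TDIsomorphic (actOn V (genA q) : Module.End F V) (actOn V (genAstar q))
      (actOn V (genA q) : Module.End F V) (actOn V (L (genAstar q))) ∧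
    TDIsomorphic (actOn V (genA q) : Module.End F V) (actOn V (genAstar q))
      (actOn V (genA q) : Module.End F V) (actOn V (L.symm (genAstar q))) ∧
    TDIsomorphic (actOn V (genA q) : Module.End F V) (actOn V (L (genAstar q)))
      (actOn V (genA q) : Module.End F V) (actOn V (L.symm (genAstar q))) ∧
    -- the map `H` is defined: a standard ordering of the eigenvalues of `A` exists
    (∃ (d : ℕ) (θ : Fin (d + 1) → F),
      IsStandardOrdering q (actOn V (genA q) : Module.End F V) θ) ∧
    -- for every standard ordering, the map `H` gives the isomorphisms
    ∀ (d : ℕ) (θ : Fin (d + 1) → F),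
      IsStandardOrdering q (actOn V (genA q) : Module.End F V) θ →
      (∃ f : V ≃ₗ[QOnsager q] Twist L V, ∀ x, f x = Twist.of L (mapH q hA θ x)) ∧
      (∃ g : Twist L.symm V ≃ₗ[QOnsager q] V, ∀ x, g (Twist.of L.symm x) = mapH q hA θ x) ∧
      IsTDIso (mapH q hA θ) (actOn V (genA q)) (actOn V (L (genAstar q)))
        (actOn V (genA q)) (actOn V (genAstar q)) ∧
      IsTDIso (mapH q hA θ) (actOn V (genA q)) (actOn V (genAstar q))
        (actOn V (genA q)) (actOn V (L.symm (genAstar q))) := by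
  refine ⟨existsUnique_isLusztig hq0 hq, ?_⟩
  intro L hL V _ _ _ _ _ _ hdim hA hB
  have hnt : Nontrivial V := Module.nontrivial_of_finrank_pos (R := F) (by omega)
  have hdg := isDolanGradyPair_actOn (q := q) V
  have hirr := actOn_irreducible (q := q) V
  have hTD := isTridiagonalPair_of_dolanGrady hq0 hq hA hB hdg hirr
  have hLB : (actOn V (L (genAstar q)) : Module.End F V) =
      lusztigElt q (actOn V (genA q)) (actOn V (genAstar q)) := by
    rw [hL.2]
    exact map_lusztigElt (Algebra.lsmul F F V) q (genA q) (genAstar q)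
  have h12 : (q - q⁻¹) * (q ^ 2 - q⁻¹ ^ 2) ≠ 0 := by
    have h1 := sub_inv_pow_ne_zero hq0 hq (n := 1) (by norm_num)
    rw [pow_one, pow_one] at h1
    exact mul_ne_zero h1 (sub_inv_pow_ne_zero hq0 hq (by norm_num))
  have hmain : ∀ (d : ℕ) (θ : Fin (d + 1) → F),
      IsStandardOrdering q (actOn V (genA q) : Module.End F V) θ →
      Function.Bijective (mapH q hA θ) ∧
      (∀ ξ v, mapH q hA θ (L ξ • v) = ξ • mapH q hA θ v) ∧
      IsTDIso (mapH q hA θ) (actOn V (genA q)) (actOn V (L (genAstar q)))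
        (actOn V (genA q)) (actOn V (genAstar q)) ∧
      IsTDIso (mapH q hA θ) (actOn V (genA q)) (actOn V (genAstar q))
        (actOn V (genA q)) (actOn V (L.symm (genAstar q))) := by
    intro d θ hθ
    have hbij := mapH_bijective h12 hq0 hA hθ
    have hcA := LinearMap.congr_fun (mapH_comm (q := q) hA hθ.1)
    have hcB := LinearMap.congr_fun (mapH_lusztigElt hq0 hq hA hdg hθ)
    rw [← hLB] at hcB
    have hint : ∀ ξ v, mapH q hA θ (L ξ • v) = ξ • mapH q hA θ v :=
      intertwines_of_gen L (by rw [hL.1]; exact hcA) hcB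
    have hiso : IsTDIso (mapH q hA θ) (actOn V (genA q)) (actOn V (genAstar q))
        (actOn V (genA q)) (actOn V (L.symm (genAstar q))) := by
      refine .of_bijective hTD hbij hcA fun v => ?_
      -- Intertwining is known for every `ξ`, so `ξ = L⁻¹(A*)` handles the third pair without a
      -- separate computation.
      have := hint (L.symm (genAstar q)) v
      rwa [AlgEquiv.apply_symm_apply] at this
    refine ⟨hbij, hint, ?_, hiso⟩
    -- Diagonalizability of `L(A*)` is not given in advance; it is carried over from `A*` by `H⁻¹`,
    -- with the other tridiagonal pair axioms.
    have hinv := hTD.of_equiv (LinearEquiv.ofBijective _ hbij).symm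
      (intertwines_symm hbij hcA) (intertwines_symm hbij hcB)
    exact .of_bijective hinv hbij hcA hcB
  obtain ⟨d, θ, hθ⟩ := exists_standardOrdering hq0 hA hdg hirr
  obtain ⟨hbij, hint, hi1, hi2⟩ := hmain d θ hθ
  refine ⟨⟨twistEquiv L hbij hint⟩, ⟨(twistSymmEquiv L hbij hint).symm⟩,
    ⟨(twistEquiv L hbij hint).symm.trans (twistSymmEquiv L hbij hint).symm⟩,
    hTD, hi1.source, hi2.target, ⟨_, hi1.symm⟩, ⟨_, hi2⟩, ⟨_, hi1.trans hi2⟩, ⟨d, θ, hθ⟩, ?_⟩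
  intro d θ hθ
  obtain ⟨hbij, hint, hi1, hi2⟩ := hmain d θ hθ
  exact ⟨⟨twistEquiv L hbij hint, fun _ => rfl⟩, ⟨twistSymmEquiv L hbij hint, fun _ => rfl⟩,
    hi1, hi2⟩
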